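/- Let $\mathbb N=\{0,1,2,\dots\}$. For $x\in\mathbb N\setminus\{0\}$ let $\lambda(x)$ and $\mu(x)$ be the smallest and the largest position of a nonzero digit in the binary expansion of $x$ (so $2^{\lambda(x)}\mid x$, $2^{\lambda(x)+1}\nmid x$ and $\mu(x)=\lfloor\log_2 x\rfloor$). A finite colouring of a set $A$ is a function $c:A\to\{0,\dots,k-1\}$ for some $k\in\mathbb N$. A finite colouring $c$ of the set $[\mathbb N]^n$ of $n$-element subsets of $\mathbb N$ is *$\mathbb Z$-invariant* if $c(\{x_1+z,\dots,x_n+z\})=c(\{x_1,\dots,x_n\})$ for all $\{x_1,\dots,x_n\}\in[\mathbb N]^n$ and $z\in\mathbb N$. An infinite set $X\subseteq\mathbb N$ with increasing enumeration $x_0<x_1<\cdots$ satisfies the *separation condition* if $\mu(x_n-x_{n-1})<\lambda(x_{n+1}-x_n)$ for all $n\ge 1$. An infinite set $Y\subseteq\mathbb N\setminus\{0\}$ with increasing enumeration $y_0<y_1<\cdots$ satisfies the *apartness condition* if $\mu(y_n)<\lambda(y_{n+1})$ for all $n\geq 0$. For $d\ge 1$ let $$\mathrm{AFS}^d(Y)=\Big\{\Big(\sum_{k=k_0}^{k_1}y_k,\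 \sum_{k=k_1+1}^{k_2}y_k,\ \dots,\ \sum_{k=k_{d-1}+1}^{k_d}y_k\Big)\ :\ k_0\le k_1<k_2<\cdots<k_d\Big\}\subseteq\mathbb N^d .$$ * $\mathrm{sep}\mathbb Z\text{-}\mathsf{RT}^{n}$ is the statement that for every $\mathbb Z$-invariant finite colouring $c$ of $[\mathbb N]^n$ there is an infinite set $X$ that satisfies the separation condition and for which $c$ is constant on $[X]^n$. As a problem, its instances are the colourings $c$ and the solutions to $c$ are the sets $X$. * $\mathrm{ap}\mathsf{AHT}^d$ is the statement that for every finite colouring $c$ of $\mathbb N^d$ there is an infinite set $Y$ that satisfies the apartness condition and for which $c$ is constant on $\mathrm{AFS}^d(Y)$. As a problem, its instances are the colourings $c$ and the solutions to $c$ are the sets $Y$. A problem $P$ is *strongly Weihrauch reducible* to a problem $Q$ if there are Turing functionals $\Phi,\Psi$ such that for every instance $c$ of $P$, $\Phi^c$ is an instance of $Q$, and for every solution $Y$ to $\Phi^c$, $\Psi^Y$ is a solution to $c$. Two problems are *strongly Weihrauch equivalent* if each of them is strongly Weihrauch reducible to the other. **Theorem.** Let $d\ge 1$. 1. The problems $\mathrm{sep}\mathbb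 Z\text{-}\mathsf{RT}^{d+1}$ and $\mathrm{ap}\mathsf{AHT}^d$ are strongly Weihrauch equivalent. 2. The statements $\mathrm{sep}\mathbb Z\text{-}\mathsf{RT}^{d+1}$ and $\mathrm{ap}\mathsf{AHT}^d$ are equivalent over $\mathsf{RCA}_0$; that is, every model of $\mathsf{RCA}_0$ (with a possibly nonstandard first-order part) satisfies one of them if and only if it satisfies the other. -/

import Mathlib

universe u

/-! ## Turing functionals and strong Weihrauch reducibility -/

namespace Weihrauch

/-- Turing functionals: the partial functionals `Φ`, with `Φ X n` the value (if any) of the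
computation with oracle `X : ℕ → ℕ` on input `n`. This is the uniform version of
`Nat.RecursiveIn`: the same scheme of computation is used for all oracles. -/
inductive IsTuringFunctional : ((ℕ → ℕ) → ℕ →. ℕ) → Prop
  | zero : IsTuringFunctional fun _ _ => Part.some 0
  | succ : IsTuringFunctional fun _ n => Part.some (n + 1)
  | left : IsTuringFunctional fun _ n => Part.some (Nat.unpair n).1
  | right : IsTuringFunctional fun _ n => Part.some (Nat.unpair n).2
  | oracle : IsTuringFunctional fun X n => Part.some (X n)
  | pair {F G : (ℕ → ℕ) → ℕ →. ℕ} (hF : IsTuringFunctional F) (hG : IsTuringFunctional G) :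
      IsTuringFunctional fun X n => Nat.pair <$> F X n <*> G X n
  | comp {F G : (ℕ → ℕ) → ℕ →. ℕ} (hF : IsTuringFunctional F) (hG : IsTuringFunctional G) :
      IsTuringFunctional fun X n => G X n >>= F X
  | prec {F G : (ℕ → ℕ) → ℕ →. ℕ} (hF : IsTuringFunctional F) (hG : IsTuringFunctional G) :
      IsTuringFunctional fun X p =>
        let (a, n) := Nat.unpair p
        n.rec (F X a) fun y IH => do
          let i ← IH
          G X (Nat.pair a (Nat.pair y i))
  | rfind {F : (ℕ → ℕ) → ℕ →. ℕ} (hF : IsTuringFunctional F) :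
      IsTuringFunctional fun X a =>
        Nat.rfind fun n => (fun m => m = 0) <$> F X (Nat.pair a n)

/-- A problem: instances, solutions, the relation "`Y` is a solution to `c`", and the coding of
instances and solutions by elements of `ℕ → ℕ`, through which functionals act on them. -/
structure Problem where
  Inst : Type
  Sol : Type
  IsSol : Inst → Sol → Prop
  instCode : Inst → ℕ → ℕ
  solCode : Sol → ℕ → ℕ

/-- `P` is strongly Weihrauch reducible to `Q`. -/
def StrongReducible (P Q : Problem) : Prop :=
  ∃ Φ Ψ : (ℕ → ℕ) → ℕ →. ℕ, IsTuringFunctional Φ ∧ IsTuringFunctional Ψ ∧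
    ∀ c : P.Inst, ∃ c' : Q.Inst,
      (∀ n, Φ (P.instCode c) n = Part.some (Q.instCode c' n)) ∧
      ∀ Y : Q.Sol, Q.IsSol c' Y → ∃ X : P.Sol,
        (∀ n, Ψ (Q.solCode Y) n = Part.some (P.solCode X n)) ∧ P.IsSol c X

/-- `P` and `Q` are strongly Weihrauch equivalent. -/
def StrongEquivalent (P Q : Problem) : Prop :=
  StrongReducible P Q ∧ StrongReducible Q P

/-- The `n`-element subsets of `ℕ`. -/
abbrev Subsets (n : ℕ) : Type := {s : Finset ℕ // s.card = n}

/-- The translate `{x + z : x ∈ s}`. -/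
def Subsets.shift {n : ℕ} (s : Subsets n) (z : ℕ) : Subsets n :=
  ⟨s.1.map (addRightEmbedding z), by rw [Finset.card_map]; exact s.2⟩

/-- `c(x + z) = c(x)` for all `n`-subsets `x` and all `z`. -/
def ZInvariant {n : ℕ} (c : Subsets n → ℕ) : Prop :=
  ∀ (s : Subsets n) (z : ℕ), c (s.shift z) = c s

/-- A colouring of `n`-subsets as an element of `ℕ → ℕ`: its value at the code of the increasing
list of the elements of `s` is `c s`, and its value at all other numbers is `0`. -/
def subsetColouringCode {n : ℕ} (c : Subsets n → ℕ) (m : ℕ) : ℕ :=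
  if h : (Denumerable.ofNat (List ℕ) m).Pairwise (· < ·) ∧
      (Denumerable.ofNat (List ℕ) m).length = n then
    c ⟨(Denumerable.ofNat (List ℕ) m).toFinset, by
      rw [List.toFinset_card_of_nodup (h.1.imp (fun hab => Nat.ne_of_lt hab))]; exact h.2⟩
  else 0

/-- A colouring of `d`-tuples as an element of `ℕ → ℕ`: its value at the code of the list
`x₁, …, x_d` is `c (x₁, …, x_d)`, and its value at all other numbers is `0`. -/
def tupleColouringCode {d : ℕ} (c : (Fin d → ℕ) → ℕ) (m : ℕ) : ℕ :=
  if h : (Denumerable.ofNat (List ℕ) m).length = d then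
    c fun i => (Denumerable.ofNat (List ℕ) m).get (i.cast h.symm)
  else 0

/-- The characteristic function of a set. -/
noncomputable def setCode (X : Set ℕ) : ℕ → ℕ := X.indicator 1

/-- The increasing enumeration of an infinite set. -/
noncomputable def enum (X : Set ℕ) : ℕ → ℕ := Nat.nth (· ∈ X)

/-- The least position of a nonzero binary digit of `x`, for `x ≠ 0`. -/
def lam (x : ℕ) : ℕ := padicValNat 2 x

/-- The largest position of a nonzero binary digit of `x`, for `x ≠ 0`. -/
def mu (x : ℕ) : ℕ := Nat.log 2 x

/-- The apartness condition. As `lam` and `mu` make sense for nonzero numbers only, the terms of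
the sequence are required to be nonzero. -/
def Apart (x : ℕ → ℕ) : Prop :=
  ∀ n, x n ≠ 0 ∧ mu (x n) < lam (x (n + 1))

/-- The separation condition for (the increasing enumeration of) a set. -/
def Separated (X : Set ℕ) : Prop :=
  ∀ n, mu (enum X (n + 1) - enum X n) < lam (enum X (n + 2) - enum X (n + 1))

/-- Adjacent `d`-tuples of adjacent sums of `x`. The summation ranges are the half-open intervals
`[k 0, k 1), [k 1, k 2), …, [k (d-1), k d)`. -/
def AFS (d : ℕ) (x : ℕ → ℕ) : Set (Fin d → ℕ) :=
  {v | ∃ k : Fin (d + 1) → ℕ, StrictMono k ∧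
    ∀ j : Fin d, v j = ∑ t ∈ Finset.Ico (k j.castSucc) (k j.succ), x t}

/-- The `ℤ`-Ramsey theorem for `n`-subsets with separation, as a problem. -/
noncomputable def sepZRT (n : ℕ) : Problem where
  Inst := {c : Subsets n → ℕ // (∃ k, ∀ s, c s < k) ∧ ZInvariant c}
  Sol := Set ℕ
  IsSol c X := X.Infinite ∧ Separated X ∧
    ∃ i, ∀ s : Subsets n, (s.1 : Set ℕ) ⊆ X → c.1 s = i
  instCode c := subsetColouringCode c.1
  solCode := setCode

/-- The `d`-dimensional adjacent Hindman theorem with apartness, as a problem. -/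
noncomputable def apAHT (d : ℕ) : Problem where
  Inst := {c : (Fin d → ℕ) → ℕ // ∃ k, ∀ v, c v < k}
  Sol := Set ℕ
  IsSol c Y := Y.Infinite ∧ Apart (enum Y) ∧
    ∃ i, ∀ v ∈ AFS d (enum Y), c.1 v = i
  instCode c := tupleColouringCode c.1
  solCode := setCode

end Weihrauch

/-! ## Models of `RCA₀`

A structure for the language of second-order arithmetic is a type `M` with `0, 1, +, *, <` (the
numbers, not necessarily standard) and a nonempty `S : Set (Set M)` (the sets). -/

namespace SecondOrderArith

/-- Adding a value for the variable `0` to an assignment, the other variables being shifted. -/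
def cons {M : Type u} (a : M) (v : ℕ → M) : ℕ → M
  | 0 => a
  | n + 1 => v n

/-- Numerical terms. -/
inductive Term : Type
  | var (n : ℕ)
  | zero
  | one
  | add (s t : Term)
  | mul (s t : Term)

/-- Bounded-quantifier formulas with number and set variables, with de Bruijn indices for number
variables: `ball t φ` is `∀ x < t, φ`, where `x` is the variable `0` of `φ`. -/
inductive BFormula : Type
  | eq (s t : Term)
  | lt (s t : Term)
  | mem (t : Term) (X : ℕ)
  | not (φ : BFormula)
  | and (φ ψ : BFormula)
  | ball (t : Term) (φ : BFormula)

section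

variable {M : Type u} [Zero M] [One M] [Add M] [Mul M] [LT M]

/-- The value of a term. -/
def Term.val (v : ℕ → M) : Term → M
  | var n => v n
  | zero => 0
  | one => 1
  | add s t => s.val v + t.val v
  | mul s t => s.val v * t.val v

/-- Truth of a bounded-quantifier formula, with set variables interpreted by `V`. -/
def BFormula.Holds (V : ℕ → Set M) : BFormula → (ℕ → M) → Prop
  | eq s t, v => s.val v = t.val v
  | lt s t, v => s.val v < t.val v
  | mem t X, v => t.val v ∈ V X
  | not φ, v => ¬ φ.Holds V v
  | and φ ψ, v => φ.Holds V v ∧ ψ.Holds V v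
  | ball t φ, v => ∀ a : M, a < t.val v → φ.Holds V (cons a v)

/-- `A` is defined by a `Σ⁰₁` formula with parameters from `M` and `S`. -/
def IsSigma1 (S : Set (Set M)) (A : Set M) : Prop :=
  ∃ (θ : BFormula) (V : ℕ → Set M) (v : ℕ → M), (∀ i, V i ∈ S) ∧
    ∀ a, a ∈ A ↔ ∃ b, θ.Holds V (cons b (cons a v))

/-- `A` is defined by a `Π⁰₁` formula with parameters from `M` and `S`. -/
def IsPi1 (S : Set (Set M)) (A : Set M) : Prop :=
  ∃ (θ : BFormula) (V : ℕ → Set M) (v : ℕ → M), (∀ i, V i ∈ S) ∧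
    ∀ a, a ∈ A ↔ ∀ b, θ.Holds V (cons b (cons a v))

/-- `(M, S)` is a model of `RCA₀`: the basic axioms, `Σ⁰₁` induction and `Δ⁰₁` comprehension. -/
structure IsModelRCA0 (S : Set (Set M)) : Prop where
  nonempty : S.Nonempty
  succ_ne_zero : ∀ m : M, m + 1 ≠ 0
  succ_inj : ∀ m n : M, m + 1 = n + 1 → m = n
  add_zero : ∀ m : M, m + 0 = m
  add_succ : ∀ m n : M, m + (n + 1) = (m + n) + 1
  mul_zero : ∀ m : M, m * 0 = 0
  mul_succ : ∀ m n : M, m * (n + 1) = m * n + m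
  not_lt_zero : ∀ m : M, ¬ m < 0
  lt_succ : ∀ m n : M, m < n + 1 ↔ (m < n ∨ m = n)
  induction : ∀ A : Set M, IsSigma1 S A → 0 ∈ A → (∀ a, a ∈ A → a + 1 ∈ A) → ∀ a, a ∈ A
  comprehension : ∀ A : Set M, IsSigma1 S A → IsPi1 S A → A ∈ S

/-- The usual pairing function of second-order arithmetic. -/
def pair (i j : M) : M := (i + j) * (i + j) + i

/-- Codes of tuples of a fixed standard length, by iterated pairing. -/
def tuple : {n : ℕ} → (Fin n → M) → M
  | 0, _ => 0
  | _ + 1, x => pair (x 0) (tuple fun i => x i.succ)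

/-- `x₁ < x₂ < ⋯ < xₙ`. -/
def Increasing {n : ℕ} (x : Fin n → M) : Prop := ∀ i j, i < j → x i < x j

/-- `C` is (the set of pairs coding) a function from the set `D` of `n`-tuples to
`{j : j < k}`. -/
def IsColouring {n : ℕ} (D : (Fin n → M) → Prop) (C : Set M) (k : M) : Prop :=
  (∀ w ∈ C, ∃ x j, D x ∧ j < k ∧ w = pair (tuple x) j) ∧
  ∀ x, D x → ∃! j, pair (tuple x) j ∈ C

/-- The colouring `C` of `n`-subsets (given as increasing `n`-tuples) is `ℤ`-invariant. -/
def ZInvariant (n : ℕ) (C : Set M) : Prop :=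
  ∀ x : Fin n → M, Increasing x → ∀ z j : M,
    pair (tuple x) j ∈ C ↔ pair (tuple fun i => x i + z) j ∈ C

/-- `X` is infinite, i.e. unbounded. -/
def Unbounded (X : Set M) : Prop := ∀ m, ∃ x ∈ X, m < x

/-- `a` and `b` are consecutive elements of `X` in its increasing enumeration. -/
def Consecutive (X : Set M) (a b : M) : Prop :=
  a ∈ X ∧ b ∈ X ∧ a < b ∧ ∀ c ∈ X, ¬ (a < c ∧ c < b)

/-- `f` is (the set of pairs coding) a function from numbers to numbers. -/
def IsFunction (f : Set M) : Prop :=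
  (∀ w ∈ f, ∃ n p, w = pair n p) ∧ ∀ n, ∃! p, pair n p ∈ f

/-- `E` is the function `n ↦ 2 ^ n`. -/
def IsExpTwo (E : Set M) : Prop :=
  IsFunction E ∧ pair 0 1 ∈ E ∧ ∀ n p, pair n p ∈ E → pair (n + 1) (p + p) ∈ E

/-- `μ(x) = m`, i.e. `2 ^ m ≤ x < 2 ^ (m + 1)`, where `E` is the function `n ↦ 2 ^ n`. -/
def IsMu (E : Set M) (x m : M) : Prop :=
  ∃ p q, pair m p ∈ E ∧ pair (m + 1) q ∈ E ∧ ¬ x < p ∧ x < q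

/-- `λ(x) = l`, i.e. `2 ^ l ∣ x` and `2 ^ (l + 1) ∤ x`, where `E` is the function `n ↦ 2 ^ n`. -/
def IsLam (E : Set M) (x l : M) : Prop :=
  ∃ p q, pair l p ∈ E ∧ pair (l + 1) q ∈ E ∧ (∃ t, x = p * t) ∧ ¬ ∃ t, x = q * t

/-- `μ(x) < λ(y)`; in particular `x` and `y` are nonzero. -/
def MuLtLam (S : Set (Set M)) (x y : M) : Prop :=
  ∃ E ∈ S, IsExpTwo E ∧ ∃ m l, IsMu E x m ∧ IsLam E y l ∧ m < l

/-- The apartness condition for (the increasing enumeration of) `Y`. -/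
def Apart (S : Set (Set M)) (Y : Set M) : Prop :=
  ∀ a b, Consecutive Y a b → MuLtLam S a b

/-- The separation condition for (the increasing enumeration of) `X`. -/
def Separated (S : Set (Set M)) (X : Set M) : Prop :=
  ∀ a b c, Consecutive X a b → Consecutive X b c →
    ∃ p q, b = a + p ∧ c = b + q ∧ MuLtLam S p q

/-- `s` is the function whose value at `m` is the sum of all elements of `Y` below `m`. -/
def IsSumFunction (Y s : Set M) : Prop :=
  IsFunction s ∧ pair 0 0 ∈ s ∧
    ∀ m p, pair m p ∈ s →
      (m ∈ Y → pair (m + 1) (p + m) ∈ s) ∧ (m ∉ Y → pair (m + 1) p ∈ s)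

/-- `z` is an adjacent `d`-tuple of adjacent sums of the infinite set `Y`: for some elements
`m₀ < m₁ < ⋯ < m_d` of `Y`, the `j`-th entry is the sum of all `y ∈ Y` with
`m_{j-1} ≤ y < m_j`, where `s` is the sum function of `Y`. -/
def IsAFS (d : ℕ) (Y s : Set M) (z : Fin d → M) : Prop :=
  ∃ m : Fin (d + 1) → M, Increasing m ∧ (∀ i, m i ∈ Y) ∧
    ∀ j : Fin d, ∃ p, pair (m j.castSucc) p ∈ s ∧ pair (m j.succ) (p + z j) ∈ s

/-- `(M, S)` satisfies the `ℤ`-Ramsey theorem for `n`-subsets with separation. -/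
def SatSepZRT (n : ℕ) (S : Set (Set M)) : Prop :=
  ∀ k : M, ∀ C ∈ S, IsColouring (fun x : Fin n → M => Increasing x) C k → ZInvariant n C →
    ∃ X ∈ S, Unbounded X ∧ Separated S X ∧
      ∃ i, ∀ x : Fin n → M, Increasing x → (∀ j, x j ∈ X) → pair (tuple x) i ∈ C

/-- `(M, S)` satisfies the `d`-dimensional adjacent Hindman theorem with apartness. -/
def SatApAHT (d : ℕ) (S : Set (Set M)) : Prop :=
  ∀ k : M, ∀ C ∈ S, IsColouring (fun _ : Fin d → M => True) C k →
    ∃ Y ∈ S, Unbounded Y ∧ Apart S Y ∧ ∃ s ∈ S, IsSumFunction Y s ∧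
      ∃ i, ∀ z : Fin d → M, IsAFS d Y s z → pair (tuple z) i ∈ C

end

end SecondOrderArith

/-! A `ℤ`-invariant colour of a `(d + 1)`-set depends only on the `d` successive differences of the
set, so `ℤ`-invariant colourings of `(d + 1)`-sets are the same as colourings of `d`-tuples of
positive numbers. Tuples with an entry `0` never arise as adjacent sums and get the default colour
`0`. On the side of solutions, let `y n = x (n + 1) - x n`. Sums telescope, so the successive
differences of `d + 1` elements of `X` are exactly the adjacent `d`-tuples of adjacent sums of `Y`,
and separation of `X` is apartness of `Y`.

What needs care is that solutions are sets, not sequences. From `Y` to `X`: a number `n` is the sum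
of an initial segment of `Y` iff it is the sum of the elements of `Y` below some `m ≤ n + 1`, which
is a bounded condition (`IsSumFunction.sumSet_mem`, `computes_partialSums`). From `X` to `Y`: `μ(a)
< λ(b)` implies `a < b`, so the gaps of `X` strictly increase; once a gap longer than `n` is found,
`n` is a gap iff it is one further to the left. This makes the set of gaps `Δ⁰₁`
(`HasIncreasingGaps.gapSet_mem`) and computable (`gaps_setCode`).

In a nonstandard model, sums of possibly nonstandard length are values of a sum function. For the
set of gaps it is `gapSum`: its value at `m` is the distance from the least element of `X` to the
first one followed by a gap of length at least `m`. -/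

set_option linter.unusedSectionVars false

/-! ## Definability by bounded formulas -/

namespace SecondOrderArith

section Definability

variable {M : Type u} [Zero M] [One M] [Add M] [Mul M]

/-- `t` is the value of a term, as a function of the assignment. -/
def TermDef (t : (ℕ → M) → M) : Prop := ∃ τ : Term, ∀ v, τ.val v = t v

namespace TermDef

variable {s t : (ℕ → M) → M}

theorem var (n : ℕ) : TermDef fun v : ℕ → M => v n := ⟨.var n, fun _ => rfl⟩

theorem zero : TermDef fun _ : ℕ → M => (0 : M) := ⟨.zero, fun _ => rfl⟩

theorem one : TermDef fun _ : ℕ → M => (1 : M) := ⟨.one, fun _ => rfl⟩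

theorem add (hs : TermDef s) (ht : TermDef t) : TermDef fun v => s v + t v :=
  let ⟨σ, hσ⟩ := hs
  let ⟨τ, hτ⟩ := ht
  ⟨.add σ τ, fun v => by simp only [Term.val, hσ, hτ]⟩

theorem mul (hs : TermDef s) (ht : TermDef t) : TermDef fun v => s v * t v :=
  let ⟨σ, hσ⟩ := hs
  let ⟨τ, hτ⟩ := ht
  ⟨.mul σ τ, fun v => by simp only [Term.val, hσ, hτ]⟩

theorem pair (hs : TermDef s) (ht : TermDef t) : TermDef fun v => pair (s v) (t v) :=
  ((hs.add ht).mul (hs.add ht)).add hs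

/-- The length `n` is standard, so recursion outside the model unfolds iterated pairing into one
term. -/
theorem tuple : ∀ {n : ℕ} {x : Fin n → (ℕ → M) → M}, (∀ i, TermDef (x i)) →
    TermDef fun v => tuple fun i => x i v
  | 0, _, _ => zero
  | _ + 1, _, hx => (hx 0).pair (tuple fun i => hx i.succ)

end TermDef

variable [LT M]

/-- `P` is defined by a bounded formula with `A` as the only set parameter. -/
def BoundedDef (A : Set M) (P : (ℕ → M) → Prop) : Prop :=
  ∃ θ : BFormula, ∀ v, θ.Holds (fun _ => A) v ↔ P v

namespace BoundedDef

variable {A : Set M} {s t : (ℕ → M) → M} {P Q : (ℕ → M) → Prop}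

theorem eq (hs : TermDef s) (ht : TermDef t) : BoundedDef A fun v => s v = t v :=
  let ⟨σ, hσ⟩ := hs
  let ⟨τ, hτ⟩ := ht
  ⟨.eq σ τ, fun v => by simp only [BFormula.Holds, hσ, hτ]⟩

theorem lt (hs : TermDef s) (ht : TermDef t) : BoundedDef A fun v => s v < t v :=
  let ⟨σ, hσ⟩ := hs
  let ⟨τ, hτ⟩ := ht
  ⟨.lt σ τ, fun v => by simp only [BFormula.Holds, hσ, hτ]⟩

theorem mem (hs : TermDef s) : BoundedDef A fun v => s v ∈ A :=
  let ⟨σ, hσ⟩ := hs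
  ⟨.mem σ 0, fun v => by simp only [BFormula.Holds, hσ]⟩

theorem not (hP : BoundedDef A P) : BoundedDef A fun v => ¬ P v :=
  let ⟨θ, hθ⟩ := hP
  ⟨.not θ, fun v => by simp only [BFormula.Holds, hθ]⟩

theorem and (hP : BoundedDef A P) (hQ : BoundedDef A Q) : BoundedDef A fun v => P v ∧ Q v :=
  let ⟨θ, hθ⟩ := hP
  let ⟨η, hη⟩ := hQ
  ⟨.and θ η, fun v => by simp only [BFormula.Holds, hθ, hη]⟩

theorem congr (hP : BoundedDef A P) (h : ∀ v, P v ↔ Q v) : BoundedDef A Q :=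
  let ⟨θ, hθ⟩ := hP
  ⟨θ, fun v => (hθ v).trans (h v)⟩

theorem or (hP : BoundedDef A P) (hQ : BoundedDef A Q) : BoundedDef A fun v => P v ∨ Q v :=
  (hP.not.and hQ.not).not.congr fun v => by tauto

theorem imp (hP : BoundedDef A P) (hQ : BoundedDef A Q) : BoundedDef A fun v => P v → Q v :=
  (hP.and hQ.not).not.congr fun v => by tauto

/-- The hypothesis reads the bound variable as `v 0` and the old assignment as the tail of `v`,
because these are the two parts of `cons a v`. -/
theorem ball {P : M → (ℕ → M) → Prop} (ht : TermDef t)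
    (hP : BoundedDef A fun v => P (v 0) fun n => v (n + 1)) :
    BoundedDef A fun v => ∀ a, a < t v → P a v :=
  let ⟨τ, hτ⟩ := ht
  let ⟨θ, hθ⟩ := hP
  ⟨.ball τ θ, fun v => by simp only [BFormula.Holds, hτ, hθ]; rfl⟩

theorem bex {P : M → (ℕ → M) → Prop} (ht : TermDef t)
    (hP : BoundedDef A fun v => P (v 0) fun n => v (n + 1)) :
    BoundedDef A fun v => ∃ a, a < t v ∧ P a v :=
  (ball (P := fun a v => ¬ P a v) ht hP.not).not.congr fun v => by push Not; rfl

theorem forall_fin : ∀ {n : ℕ} {P : Fin n → (ℕ → M) → Prop}, (∀ i, BoundedDef A (P i)) →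
    BoundedDef A fun v => ∀ i, P i v
  | 0, _, _ => (eq .zero .zero).congr fun v => by simp
  | _ + 1, _, h => ((h 0).and (forall_fin fun i => h i.succ)).congr fun v => by
      rw [Fin.forall_fin_succ]

/-- Several existential quantifiers bounded by the same variable. -/
theorem bex_fin : ∀ {n : ℕ} {m : ℕ} {P : (Fin n → M) → (ℕ → M) → Prop},
    (BoundedDef A fun v => P (fun i => v i) fun k => v (k + n)) →
    BoundedDef A fun v => ∃ x : Fin n → M, (∀ i, x i < v m + 1) ∧ P x v
  | 0, _, P, h => h.congr fun v =>
      ⟨fun hP => ⟨_, fun i => i.elim0, hP⟩, fun ⟨x, _, hx⟩ => by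
        rwa [Subsingleton.elim (fun i : Fin 0 => v i) x]⟩
  | n + 1, m, P, h => by
      -- The last entry is quantified outermost: the `n` inner binders push it to index `n`, so that
      -- the entries occupy the indices `0, …, n` in order.
      have h' : BoundedDef A fun v => P (Fin.snoc (fun i : Fin n => v i) (v (0 + n)))
          fun k => v (k + 1 + n) := by
        refine h.congr fun v => iff_of_eq (congrArg₂ P (funext fun i => ?_) (funext fun k => ?_))
        · refine Fin.lastCases ?_ (fun i => ?_) i <;> simp
        · rw [Nat.add_assoc, Nat.add_comm 1 n]
      refine (bex (P := fun a v => ∃ x : Fin n → M, (∀ i, x i < v m + 1) ∧ P (Fin.snoc x a) v)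
        (.add (.var m) .one) (bex_fin (m := m + 1)
          (P := fun x v => P (Fin.snoc x (v 0)) fun k => v (k + 1)) h')).congr fun v => ?_
      constructor
      · rintro ⟨a, ha, x, hx, hP⟩
        refine ⟨_, fun i => ?_, hP⟩
        refine Fin.lastCases ?_ (fun i => ?_) i
        · simpa using ha
        · simpa using hx i
      · rintro ⟨x, hx, hP⟩
        refine ⟨x (Fin.last n), hx _, Fin.init x, fun i => hx _, ?_⟩
        rwa [Fin.snoc_init_self]

end BoundedDef

/-- This fixes the convention for all later formulas: `v 0` is the unbounded witness, `v 1` the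
element, and the parameters start at `v 2`. -/
theorem BoundedDef.isSigma1 {A : Set M} {S : Set (Set M)} (hA : A ∈ S) {P : (ℕ → M) → Prop}
    (hP : BoundedDef A P) (v : ℕ → M) : IsSigma1 S {a | ∃ b, P (cons b (cons a v))} :=
  let ⟨θ, hθ⟩ := hP
  ⟨θ, fun _ => A, v, fun _ => hA, fun a => by simp only [hθ]; rfl⟩

theorem BoundedDef.isPi1 {A : Set M} {S : Set (Set M)} (hA : A ∈ S) {P : (ℕ → M) → Prop}
    (hP : BoundedDef A P) (v : ℕ → M) : IsPi1 S {a | ∀ b, P (cons b (cons a v))} :=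
  let ⟨θ, hθ⟩ := hP
  ⟨θ, fun _ => A, v, fun _ => hA, fun a => by simp only [hθ]; rfl⟩

/-- An assignment with the given values followed by zeros. -/
def assign : List M → ℕ → M
  | [] => fun _ => 0
  | a :: l => cons a (assign l)

end Definability

/-! ### Arithmetic in a model of `RCA₀`: the numbers form an ordered semiring -/

section Arithmetic

variable {M : Type u} [Zero M] [One M] [Add M] [Mul M] [LT M] {S : Set (Set M)}

namespace IsModelRCA0

/-- Induction for `∃ b, P b a`, where `P` is defined by a bounded formula. -/
theorem induction_exists (hS : IsModelRCA0 S) {A : Set M} (hA : A ∈ S) (l : List M)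
    {P : M → M → (ℕ → M) → Prop}
    (hP : BoundedDef A fun v => P (v 0) (v 1) fun n => v (n + 2))
    (h0 : ∃ b, P b 0 (assign l))
    (hs : ∀ a, (∃ b, P b a (assign l)) → ∃ b, P b (a + 1) (assign l)) (a : M) :
    ∃ b, P b a (assign l) :=
  hS.induction _ (hP.isSigma1 hA (assign l)) h0 hs a

/-- Induction for `P a`, where `P` is defined by a bounded formula. -/
theorem induction_bounded (hS : IsModelRCA0 S) {A : Set M} (hA : A ∈ S) (l : List M)
    {P : M → (ℕ → M) → Prop} (hP : BoundedDef A fun v => P (v 1) fun n => v (n + 2))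
    (h0 : P 0 (assign l)) (hs : ∀ a, P a (assign l) → P (a + 1) (assign l)) (a : M) :
    P a (assign l) := by
  have := hS.induction_exists hA l (P := fun _ a v => P a v) hP ⟨0, h0⟩
    (fun a ⟨_, h⟩ => ⟨0, hs a h⟩) a
  exact this.elim fun _ h => h

/-- `Δ⁰₁` comprehension. -/
theorem setOf_mem_of_iff (hS : IsModelRCA0 S) {A : Set M} (hA : A ∈ S) (l : List M) {B : Set M}
    {P Q : M → M → (ℕ → M) → Prop}
    (hP : BoundedDef A fun v => P (v 0) (v 1) fun n => v (n + 2))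
    (hQ : BoundedDef A fun v => Q (v 0) (v 1) fun n => v (n + 2))
    (hBP : ∀ a, a ∈ B ↔ ∃ b, P b a (assign l)) (hBQ : ∀ a, a ∈ B ↔ ∀ b, Q b a (assign l)) :
    B ∈ S := by
  have h₁ := hP.isSigma1 hA (assign l)
  have h₂ := hQ.isPi1 hA (assign l)
  refine hS.comprehension B ?_ ?_
  · convert h₁ using 1
    exact Set.ext hBP
  · convert h₂ using 1
    exact Set.ext hBQ

/-- Comprehension for bounded formulas. -/
theorem setOf_mem (hS : IsModelRCA0 S) {A : Set M} (hA : A ∈ S) (l : List M)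
    {P : M → (ℕ → M) → Prop} (hP : BoundedDef A fun v => P (v 1) fun n => v (n + 2)) :
    {a | P a (assign l)} ∈ S :=
  hS.setOf_mem_of_iff hA l (P := fun _ a v => P a v) (Q := fun _ a v => P a v) hP hP
    (fun _ => ⟨fun h => ⟨0, h⟩, fun ⟨_, h⟩ => h⟩) fun _ => ⟨fun h _ => h, fun h => h 0⟩

protected theorem zero_add (hS : IsModelRCA0 S) (a : M) : 0 + a = a := by
  -- The formula has no set variables, but these must still be interpreted; any member of `S`
  -- serves.
  obtain ⟨A, hA⟩ := hS.nonempty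
  exact hS.induction_bounded hA [] (P := fun a _ => 0 + a = a) (.eq (.add .zero (.var _)) (.var _))
    (hS.add_zero 0) (fun a h => by rw [hS.add_succ, h]) a

protected theorem add_assoc (hS : IsModelRCA0 S) (a b c : M) : a + b + c = a + (b + c) := by
  obtain ⟨A, hA⟩ := hS.nonempty
  refine hS.induction_bounded hA [a, b] (P := fun c v => v 0 + v 1 + c = v 0 + (v 1 + c))
    (.eq (.add (.add (.var _) (.var _)) (.var _)) (.add (.var _) (.add (.var _) (.var _)))) ?_ ?_ c
  · simp only [hS.add_zero]
  · intro c h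
    rw [hS.add_succ, h, hS.add_succ, hS.add_succ]

protected theorem succ_add (hS : IsModelRCA0 S) (a b : M) : a + 1 + b = a + b + 1 := by
  obtain ⟨A, hA⟩ := hS.nonempty
  refine hS.induction_bounded hA [a] (P := fun b v => v 0 + 1 + b = v 0 + b + 1)
    (.eq (.add (.add (.var _) .one) (.var _)) (.add (.add (.var _) (.var _)) .one)) ?_ ?_ b
  · simp only [hS.add_zero]
  · intro b h
    rw [hS.add_succ, h, hS.add_succ]

protected theorem add_comm (hS : IsModelRCA0 S) (a b : M) : a + b = b + a := by
  obtain ⟨A, hA⟩ := hS.nonempty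
  refine hS.induction_bounded hA [a] (P := fun b v => v 0 + b = b + v 0)
    (.eq (.add (.var _) (.var _)) (.add (.var _) (.var _))) ?_ ?_ b
  · rw [hS.add_zero, hS.zero_add]
  · intro b h
    rw [hS.add_succ, h, hS.succ_add]

protected theorem add_right_comm (hS : IsModelRCA0 S) (a b c : M) : a + b + c = a + c + b := by
  rw [hS.add_assoc, hS.add_comm b c, hS.add_assoc]

protected theorem zero_mul (hS : IsModelRCA0 S) (a : M) : 0 * a = 0 := by
  obtain ⟨A, hA⟩ := hS.nonempty
  exact hS.induction_bounded hA [] (P := fun a _ => 0 * a = 0) (.eq (.mul .zero (.var _)) .zero)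
    (hS.mul_zero 0) (fun a h => by rw [hS.mul_succ, h, hS.add_zero]) a

protected theorem succ_mul (hS : IsModelRCA0 S) (a b : M) : (a + 1) * b = a * b + b := by
  obtain ⟨A, hA⟩ := hS.nonempty
  refine hS.induction_bounded hA [a] (P := fun b v => (v 0 + 1) * b = v 0 * b + b)
    (.eq (.mul (.add (.var _) .one) (.var _)) (.add (.mul (.var _) (.var _)) (.var _))) ?_ ?_ b
  · rw [hS.mul_zero, hS.mul_zero, hS.add_zero]
  · intro b h
    rw [hS.mul_succ, h, hS.mul_succ, hS.add_succ, hS.add_succ]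
    exact congrArg (· + 1) (hS.add_right_comm _ _ _)

protected theorem mul_comm (hS : IsModelRCA0 S) (a b : M) : a * b = b * a := by
  obtain ⟨A, hA⟩ := hS.nonempty
  refine hS.induction_bounded hA [a] (P := fun b v => v 0 * b = b * v 0)
    (.eq (.mul (.var _) (.var _)) (.mul (.var _) (.var _))) ?_ ?_ b
  · rw [hS.mul_zero, hS.zero_mul]
  · intro b h
    rw [hS.mul_succ, h, hS.succ_mul]

protected theorem mul_add (hS : IsModelRCA0 S) (a b c : M) : a * (b + c) = a * b + a * c := by
  obtain ⟨A, hA⟩ := hS.nonempty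
  refine hS.induction_bounded hA [a, b] (P := fun c v => v 0 * (v 1 + c) = v 0 * v 1 + v 0 * c)
    (.eq (.mul (.var _) (.add (.var _) (.var _)))
      (.add (.mul (.var _) (.var _)) (.mul (.var _) (.var _)))) ?_ ?_ c
  · rw [hS.mul_zero, hS.add_zero, hS.add_zero]
  · intro c h
    rw [hS.add_succ, hS.mul_succ, h, hS.mul_succ, hS.add_assoc]

protected theorem mul_assoc (hS : IsModelRCA0 S) (a b c : M) : a * b * c = a * (b * c) := by
  obtain ⟨A, hA⟩ := hS.nonempty
  refine hS.induction_bounded hA [a, b] (P := fun c v => v 0 * v 1 * c = v 0 * (v 1 * c))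
    (.eq (.mul (.mul (.var _) (.var _)) (.var _)) (.mul (.var _) (.mul (.var _) (.var _)))) ?_ ?_ c
  · simp only [hS.mul_zero]
  · intro c h
    rw [hS.mul_succ, h, hS.mul_succ, hS.mul_add]

protected theorem mul_one (hS : IsModelRCA0 S) (a : M) : a * 1 = a := by
  rw [← hS.zero_add 1, hS.mul_succ, hS.mul_zero, hS.zero_add]

protected theorem add_left_cancel (hS : IsModelRCA0 S) {a b c : M} (h : c + a = c + b) : a = b := by
  obtain ⟨A, hA⟩ := hS.nonempty
  rw [hS.add_comm c, hS.add_comm c] at h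
  refine hS.induction_bounded hA [a, b] (P := fun c v => v 0 + c = v 1 + c → v 0 = v 1)
    (.imp (.eq (.add (.var _) (.var _)) (.add (.var _) (.var _))) (.eq (.var _) (.var _)))
    ?_ ?_ c h
  · simp only [hS.add_zero, imp_self]
  · intro c ih h
    rw [hS.add_succ, hS.add_succ] at h
    exact ih (hS.succ_inj _ _ h)

theorem eq_zero_or_succ (hS : IsModelRCA0 S) (a : M) : a = 0 ∨ ∃ b, a = b + 1 := by
  obtain ⟨A, hA⟩ := hS.nonempty
  obtain ⟨b, h⟩ := hS.induction_exists hA [] (P := fun b a _ => a = 0 ∨ a = b + 1)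
    (.or (.eq (.var _) .zero) (.eq (.var _) (.add (.var _) .one)))
    ⟨0, Or.inl rfl⟩ (fun a _ => ⟨a, Or.inr rfl⟩) a
  exact h.imp_right fun h => ⟨b, h⟩

theorem eq_zero_of_add_eq_zero (hS : IsModelRCA0 S) {a b : M} (h : a + b = 0) : b = 0 := by
  obtain rfl | ⟨b, rfl⟩ := hS.eq_zero_or_succ b
  · rfl
  · rw [hS.add_succ] at h
    exact absurd h (hS.succ_ne_zero _)

/-- The axioms describe `<` only at `0` and at successors. Identifying it with the additive order is
what allows the linear order to be defined through addition. -/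
theorem lt_iff_exists (hS : IsModelRCA0 S) (a b : M) : a < b ↔ ∃ c, b = a + (c + 1) := by
  obtain ⟨A, hA⟩ := hS.nonempty
  constructor
  · intro hab
    obtain ⟨c, h⟩ := hS.induction_exists hA [a] (P := fun c b v => v 0 < b → b = v 0 + (c + 1))
      (.imp (.lt (.var _) (.var _)) (.eq (.var _) (.add (.var _) (.add (.var _) .one))))
      ⟨0, fun h => absurd h (hS.not_lt_zero _)⟩ (fun b ⟨c, hc⟩ => by
        by_cases hab : a < b
        · exact ⟨c + 1, fun _ => by rw [hc hab, ← hS.add_succ]⟩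
        · refine ⟨0, fun h => ?_⟩
          rw [hS.zero_add, ((hS.lt_succ _ _).1 h).resolve_left hab]) b
    exact ⟨c, h hab⟩
  · rintro ⟨c, rfl⟩
    refine hS.induction_bounded hA [a] (P := fun c v => v 0 < v 0 + (c + 1))
      (.lt (.var _) (.add (.var _) (.add (.var _) .one))) ?_ (fun c h => ?_) c
    · rw [hS.add_succ, hS.add_zero, hS.lt_succ]
      exact Or.inr rfl
    · rw [hS.add_succ, hS.lt_succ]
      exact Or.inl h

theorem exists_add_or (hS : IsModelRCA0 S) (a b : M) : ∃ c, b = a + c ∨ a = b + c := by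
  obtain ⟨A, hA⟩ := hS.nonempty
  refine hS.induction_exists hA [b] (P := fun c a v => v 0 = a + c ∨ a = v 0 + c)
    (.or (.eq (.var _) (.add (.var _) (.var _))) (.eq (.var _) (.add (.var _) (.var _))))
    ⟨b, Or.inl (hS.zero_add b).symm⟩ ?_ a
  rintro a ⟨c, (h : b = a + c) | (h : a = b + c)⟩
  · obtain rfl | ⟨c, rfl⟩ := hS.eq_zero_or_succ c
    · exact ⟨1, Or.inr (by rw [h, hS.add_zero]; rfl)⟩
    · exact ⟨c, Or.inl (by rw [hS.succ_add, ← hS.add_succ]; exact h)⟩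
  · exact ⟨c + 1, Or.inr (by rw [hS.add_succ, h]; rfl)⟩

/-- The numbers of a model form a commutative semiring. -/
abbrev commSemiring (hS : IsModelRCA0 S) : CommSemiring M where
  add_assoc := hS.add_assoc
  zero_add := hS.zero_add
  add_zero := hS.add_zero
  add_comm := hS.add_comm
  nsmul := nsmulRec
  left_distrib := hS.mul_add
  right_distrib a b c := by rw [hS.mul_comm, hS.mul_add, hS.mul_comm c, hS.mul_comm c]
  zero_mul := hS.zero_mul
  mul_zero := hS.mul_zero
  mul_assoc := hS.mul_assoc
  one_mul a := by rw [hS.mul_comm, hS.mul_one]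
  mul_one := hS.mul_one
  mul_comm := hS.mul_comm

/-- The numbers of a model are linearly ordered. -/
noncomputable abbrev linearOrder (hS : IsModelRCA0 S) : LinearOrder M where
  le a b := ∃ c, b = a + c
  le_refl a := ⟨0, (hS.add_zero a).symm⟩
  le_trans := by
    rintro a _ _ ⟨c, rfl⟩ ⟨e, rfl⟩
    exact ⟨c + e, hS.add_assoc _ _ _⟩
  lt_iff_le_not_ge a b := by
    rw [hS.lt_iff_exists]
    constructor
    · rintro ⟨c, rfl⟩
      refine ⟨⟨_, rfl⟩, fun ⟨e, he⟩ => hS.succ_ne_zero c ?_⟩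
      rw [hS.add_assoc] at he
      have := hS.add_left_cancel ((hS.add_zero a).trans he)
      exact hS.eq_zero_of_add_eq_zero (hS.add_comm _ _ ▸ this.symm)
    · rintro ⟨⟨c, rfl⟩, h⟩
      obtain rfl | ⟨c, rfl⟩ := hS.eq_zero_or_succ c
      · exact absurd ⟨0, by rw [hS.add_zero, hS.add_zero]⟩ h
      · exact ⟨c, rfl⟩
  le_antisymm := by
    rintro a b ⟨c, rfl⟩ ⟨e, he⟩
    rw [hS.add_assoc] at he
    have := hS.add_left_cancel ((hS.add_zero a).trans he)
    rw [hS.eq_zero_of_add_eq_zero ((hS.add_comm e c).trans this.symm), hS.add_zero]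
  le_total a b := by
    obtain ⟨c, h | h⟩ := hS.exists_add_or a b
    · exact Or.inl ⟨c, h⟩
    · exact Or.inr ⟨c, h⟩
  toDecidableLE := Classical.decRel _

theorem isStrictOrderedRing (hS : IsModelRCA0 S) :
    @IsStrictOrderedRing M hS.commSemiring.toSemiring hS.linearOrder.toPartialOrder := by
  let _ := hS.commSemiring
  let _ := hS.linearOrder
  have : IsOrderedCancelAddMonoid M :=
    { add_le_add_left := by
        rintro a _ ⟨e, rfl⟩ c
        exact ⟨e, hS.add_right_comm _ _ _⟩
      le_of_add_le_add_left := by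
        rintro a b c ⟨e, he⟩
        exact ⟨e, hS.add_left_cancel (c := a) (he.trans (hS.add_assoc _ _ _))⟩ }
  have : Nontrivial M :=
    ⟨0, 1, fun h => hS.succ_ne_zero 0 ((hS.zero_add 1).trans h.symm)⟩
  have key : ∀ a : M, 0 < a → ∀ b c : M, b < c → a * b < a * c := by
    intro a ha b c hbc
    obtain ⟨e, rfl⟩ := (hS.lt_iff_exists _ _).1 hbc
    obtain ⟨f, hf⟩ := (hS.lt_iff_exists _ _).1 ha
    rw [hS.zero_add] at hf
    -- Since `a = f + 1`, the increment `a * (e + 1)` equals `(a * e + f) + 1`.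
    refine (hS.lt_iff_exists _ _).2 ⟨a * e + f, ?_⟩
    rw [hS.mul_add, hS.mul_succ, hS.add_assoc, ← hf]
  exact
    { zero_le_one := ⟨1, (hS.zero_add 1).symm⟩
      mul_lt_mul_of_pos_left := key
      mul_lt_mul_of_pos_right := fun a ha b c h => by
        change b * a < c * a
        rw [hS.mul_comm b, hS.mul_comm c]
        exact key a ha b c h }

theorem canonicallyOrderedAdd (hS : IsModelRCA0 S) :
    @CanonicallyOrderedAdd M _ hS.linearOrder.toLE := by
  let _ := hS.linearOrder
  exact
    { exists_add_of_le := fun h => h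
      le_add_self := fun a b => ⟨b, hS.add_comm _ _⟩
      le_self_add := fun a b => ⟨b, rfl⟩ }

end IsModelRCA0

end Arithmetic

end SecondOrderArith

/-! ## The order, pairs, and minimal elements -/

namespace SecondOrderArith

section Pairs

variable {M : Type u} [CommSemiring M] [LinearOrder M] [IsStrictOrderedRing M]
  [CanonicallyOrderedAdd M] {S : Set (Set M)}

theorem IsModelRCA0.lt_add_one_iff (hS : IsModelRCA0 S) {a b : M} : a < b + 1 ↔ a ≤ b := by
  rw [hS.lt_succ, le_iff_lt_or_eq]

theorem IsModelRCA0.add_one_le_iff (hS : IsModelRCA0 S) {a b : M} : a + 1 ≤ b ↔ a < b := by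
  rw [← not_lt, hS.lt_add_one_iff, not_le]

theorem IsModelRCA0.one_le_iff_ne_zero (hS : IsModelRCA0 S) {a : M} : 1 ≤ a ↔ a ≠ 0 := by
  rw [← zero_add (1 : M), hS.add_one_le_iff, pos_iff_ne_zero]

theorem left_le_pair (a b : M) : a ≤ pair a b := le_add_self

theorem IsModelRCA0.right_le_pair (hS : IsModelRCA0 S) (a b : M) : b ≤ pair a b := by
  rcases eq_or_ne b 0 with rfl | hb
  · exact zero_le
  · have h : 1 ≤ a + b := (hS.one_le_iff_ne_zero.2 hb).trans le_add_self
    calc b ≤ a + b := le_add_self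
      _ = (a + b) * 1 := (mul_one _).symm
      _ ≤ (a + b) * (a + b) := mul_le_mul_right h _
      _ ≤ pair a b := le_self_add

/-- With `s = a + b`, the code `s * s + a` lies in the interval from `s * s` up to, but excluding,
`(s + 1) * (s + 1)`; hence it determines `s`. -/
theorem IsModelRCA0.add_le_of_pair_le (hS : IsModelRCA0 S) {a b a' b' : M}
    (h : pair a b = pair a' b') : a + b ≤ a' + b' := by
  by_contra! hlt
  have h₁ := mul_le_mul' (hS.add_one_le_iff.2 hlt) (hS.add_one_le_iff.2 hlt)
  have h₂ : a' ≤ (a' + b') + (a' + b') := le_self_add.trans le_self_add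
  have h₃ : 0 ≤ a := zero_le
  unfold pair at h
  have h₄ : (0 : M) < 1 := one_pos
  have h₅ : (a' + b' + 1) * (a' + b' + 1) = (a' + b') * (a' + b') + ((a' + b') + (a' + b')) + 1 := by
    ring
  rw [h₅] at h₁
  -- With the products made opaque, the remaining contradiction is linear.
  generalize (a + b) * (a + b) = x at *
  generalize (a' + b') * (a' + b') = y at *
  generalize (a' + b') + (a' + b') = z at *
  grind

theorem IsModelRCA0.pair_inj (hS : IsModelRCA0 S) {a b a' b' : M} :
    pair a b = pair a' b' ↔ a = a' ∧ b = b' := by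
  refine ⟨fun h => ?_, fun ⟨h₁, h₂⟩ => by rw [h₁, h₂]⟩
  have hs := (hS.add_le_of_pair_le h).antisymm (hS.add_le_of_pair_le h.symm)
  unfold pair at h
  rw [hs] at h
  have ha := add_left_cancel h
  subst ha
  exact ⟨rfl, add_left_cancel hs⟩

theorem IsModelRCA0.tuple_injective (hS : IsModelRCA0 S) :
    ∀ {n : ℕ}, Function.Injective (tuple : (Fin n → M) → M)
  | 0, _, _, _ => Subsingleton.elim _ _
  | n + 1, x, y, h => by
      obtain ⟨h₀, h₁⟩ := hS.pair_inj.1 h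
      have h₂ := hS.tuple_injective h₁
      funext i
      exact Fin.cases h₀ (fun i => congrFun h₂ i) i

/-- Such bounds turn quantifiers over the entries of a coded tuple into bounded ones. -/
theorem IsModelRCA0.le_tuple (hS : IsModelRCA0 S) :
    ∀ {n : ℕ} (x : Fin n → M) (i : Fin n), x i ≤ tuple x
  | 0, _, i => i.elim0
  | n + 1, x, i => by
      refine Fin.cases (left_le_pair _ _) (fun i => ?_) i
      exact (hS.le_tuple (fun i => x i.succ) i).trans (hS.right_le_pair _ _)

theorem BoundedDef.le {A : Set M} {s t : (ℕ → M) → M} (hs : TermDef s) (ht : TermDef t) :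
    BoundedDef A fun v => s v ≤ t v :=
  (BoundedDef.lt ht hs).not.congr fun _ => not_lt

/-- Every nonempty set has a least element. -/
theorem IsModelRCA0.exists_isLeast (hS : IsModelRCA0 S) {A : Set M} (hA : A ∈ S)
    (hne : A.Nonempty) : ∃ a, IsLeast A a := by
  by_contra! h
  obtain ⟨a, ha⟩ := hne
  refine hS.induction_bounded hA [] (P := fun a _ => ∀ b, b < a → b ∉ A)
    (.ball (.var _) (.not (.mem (.var _)))) (fun b hb => absurd hb (hS.not_lt_zero b)) ?_
    (a + 1) a (hS.lt_add_one_iff.2 le_rfl) ha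
  intro a ih b hb hbA
  rcases (hS.lt_add_one_iff.1 hb).lt_or_eq with hb | rfl
  · exact ih b hb hbA
  · exact h b ⟨hbA, fun c hc => not_lt.1 fun hcb => ih c hcb hc⟩

/-- Every bounded nonempty set has a greatest element. -/
theorem IsModelRCA0.exists_isGreatest_lt (hS : IsModelRCA0 S) {A : Set M} (hA : A ∈ S) {a b : M}
    (ha : a ∈ A) (hab : a < b) : ∃ c, IsGreatest {x ∈ A | x < b} c := by
  -- The maximum is obtained as the least upper bound; being an upper bound is a bounded property.
  -- If the least one were a successor outside the set, its predecessor would be an upper bound too.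
  have hB : {c | ∀ x, x < b → x ∈ A → x ≤ c} ∈ S :=
    hS.setOf_mem hA [b] (P := fun c v => ∀ x, x < v 0 → x ∈ A → x ≤ c)
      (.ball (.var _) (.imp (.mem (.var _)) (.le (.var _) (.var _))))
  obtain ⟨c, hc, hmin⟩ := hS.exists_isLeast hB ⟨b, fun x hx _ => hx.le⟩
  refine ⟨c, ?_, fun x hx => hc x hx.2 hx.1⟩
  by_contra hcA
  obtain rfl | ⟨e, rfl⟩ := hS.eq_zero_or_succ c
  · have := hc a hab ha
    obtain rfl : a = 0 := le_antisymm this zero_le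
    exact hcA ⟨ha, hab⟩
  · refine (hmin (a := e) fun x hx hxA => ?_).not_gt (hS.lt_add_one_iff.2 le_rfl)
    rcases (hc x hx hxA).lt_or_eq with h | rfl
    · exact hS.lt_add_one_iff.1 h
    · exact absurd ⟨hxA, hx⟩ hcA

theorem IsModelRCA0.exists_isLeast_gt (hS : IsModelRCA0 S) {X : Set M} (hX : X ∈ S)
    (hu : Unbounded X) (a : M) : ∃ b, IsLeast {x ∈ X | a < x} b :=
  hS.exists_isLeast (hS.setOf_mem hX [a] (P := fun x v => x ∈ X ∧ v 0 < x)
      (.and (.mem (.var _)) (.lt (.var _) (.var _)))) <|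
    let ⟨x, hx, hax⟩ := hu a
    ⟨x, hx, hax⟩

theorem IsModelRCA0.exists_consecutive (hS : IsModelRCA0 S) {X : Set M} (hX : X ∈ S)
    (hu : Unbounded X) {a : M} (ha : a ∈ X) : ∃ b, Consecutive X a b := by
  obtain ⟨b, hb, hmin⟩ := hS.exists_isLeast_gt hX hu a
  exact ⟨b, ha, hb.1, hb.2, fun c hc h => (hmin ⟨hc, h.1⟩).not_gt h.2⟩

/-- Every element except the first one has a predecessor. -/
theorem IsModelRCA0.exists_consecutive_of_lt (hS : IsModelRCA0 S) {X : Set M} (hX : X ∈ S)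
    {a b : M} (ha : a ∈ X) (hb : b ∈ X) (hab : a < b) : ∃ c, a ≤ c ∧ Consecutive X c b := by
  obtain ⟨c, hc, hmax⟩ := hS.exists_isGreatest_lt hX ha hab
  exact ⟨c, hmax ⟨ha, hab⟩, hc.1, hb, hc.2, fun x hx h => (hmax ⟨hx, h.2⟩).not_gt h.1⟩

end Pairs

end SecondOrderArith

/-! ## From the adjacent Hindman theorem to the `ℤ`-Ramsey theorem -/

namespace SecondOrderArith

section SumSets

variable {M : Type u} [CommSemiring M] [LinearOrder M] [IsStrictOrderedRing M]
  [CanonicallyOrderedAdd M] {S : Set (Set M)}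

theorem IsFunction.unique {f : Set M} (hf : IsFunction f) {n p q : M} (hp : pair n p ∈ f)
    (hq : pair n q ∈ f) : p = q :=
  (hf.2 n).unique hp hq

theorem IsFunction.monotone (hS : IsModelRCA0 S) {f : Set M} (hfS : f ∈ S) (hf : IsFunction f)
    (hstep : ∀ n p, pair n p ∈ f → ∃ q, p ≤ q ∧ pair (n + 1) q ∈ f) {m n p q : M} (hmn : m ≤ n)
    (hp : pair m p ∈ f) (hq : pair n q ∈ f) : p ≤ q := by
  obtain ⟨k, rfl⟩ := exists_add_of_le hmn
  obtain ⟨b, hb, hpb⟩ := hS.induction_exists hfS [m, p]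
    (P := fun b k v => pair (v 0 + k) b ∈ f ∧ v 1 ≤ b)
    (.and (.mem (.pair (.add (.var _) (.var _)) (.var _))) (.le (.var _) (.var _)))
    ⟨p, by rwa [add_zero], le_rfl⟩ (fun k ⟨b, hb, hpb⟩ => by
      obtain ⟨q, hq, h⟩ := hstep _ _ hb
      exact ⟨q, by rwa [← add_assoc], hpb.trans hq⟩) k
  exact hpb.trans_eq (hf.unique hb hq)

theorem IsExpTwo.monotone (hS : IsModelRCA0 S) {E : Set M} (hES : E ∈ S) (hE : IsExpTwo E)
    {m n p q : M} (hmn : m ≤ n) (hp : pair m p ∈ E) (hq : pair n q ∈ E) : p ≤ q :=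
  hE.1.monotone hS hES (fun n p h => ⟨p + p, le_self_add, hE.2.2 n p h⟩) hmn hp hq

/-- `1 ≤ 2 ^ m ≤ x < 2 ^ (m + 1) ≤ 2 ^ l ≤ y`. No other consequence of apartness or separation is
needed; otherwise the condition is only carried over. -/
theorem MuLtLam.pos_and_lt (hS : IsModelRCA0 S) {x y : M} (h : MuLtLam S x y) : 0 < x ∧ x < y := by
  obtain ⟨E, hES, hE, m, l, ⟨p, q, hp, hq, hpx, hxq⟩, ⟨p', q', hp', -, ⟨t, rfl⟩, hny⟩, hml⟩ := h
  have h₁ := hE.monotone hS hES zero_le hE.2.1 hp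
  have h₂ := hE.monotone hS hES (hS.add_one_le_iff.2 hml) hq hp'
  refine ⟨one_pos.trans_le (h₁.trans (not_lt.1 hpx)), hxq.trans_le (h₂.trans ?_)⟩
  have ht : t ≠ 0 := by
    rintro rfl
    exact hny ⟨0, by simp⟩
  calc p' = p' * 1 := (mul_one _).symm
    _ ≤ p' * t := mul_le_mul_right (hS.one_le_iff_ne_zero.2 ht) _

theorem IsSumFunction.monotone (hS : IsModelRCA0 S) {Y s : Set M} (hsS : s ∈ S)
    (hs : IsSumFunction Y s) {m n p q : M} (hmn : m ≤ n) (hp : pair m p ∈ s)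
    (hq : pair n q ∈ s) : p ≤ q := by
  refine hs.1.monotone hS hsS (fun n p h => ?_) hmn hp hq
  by_cases hn : n ∈ Y
  · exact ⟨p + n, le_self_add, (hs.2.2 n p h).1 hn⟩
  · exact ⟨p, le_rfl, (hs.2.2 n p h).2 hn⟩

/-- Lets the argument of the sum function move up to the next element of `Y`. -/
theorem IsSumFunction.eq_of_disjoint (hS : IsModelRCA0 S) {Y s : Set M} (hsS : s ∈ S)
    (hs : IsSumFunction Y s) {m n p : M} (hmn : m ≤ n) (hp : pair m p ∈ s)
    (hY : ∀ y ∈ Y, m ≤ y → n ≤ y) : pair n p ∈ s := by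
  obtain ⟨k, rfl⟩ := exists_add_of_le hmn
  refine hS.induction_bounded hsS [m, k, p]
    (P := fun j v => j ≤ v 1 → pair (v 0 + j) (v 2) ∈ s)
    (.imp (.le (.var _) (.var _)) (.mem (.pair (.add (.var _) (.var _)) (.var _))))
    (fun _ => ?_) (fun j ih hj => ?_) k le_rfl
  · change pair (m + 0) p ∈ s
    rwa [add_zero]
  · change pair (m + (j + 1)) p ∈ s
    have hj : j < k := hS.add_one_le_iff.1 hj
    rw [← add_assoc]
    exact (hs.2.2 _ _ (ih hj.le)).2 fun h =>
      (hY _ h le_self_add).not_gt (add_lt_add_right hj m)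

/-- The set of the sums of initial segments, given by the sum function. -/
def sumSet (s : Set M) : Set M := {x | ∃ m, pair m x ∈ s}

/-- The least `m` at which `s` takes the value `x` is `0` or some `n + 1` with `n ∈ Y`, for
otherwise `n` would do. In the latter case `n` is a summand of `x`, so `m ≤ x + 1` and the
quantifier over `m` can be bounded. -/
theorem IsSumFunction.sumSet_mem (hS : IsModelRCA0 S) {Y s : Set M} (hsS : s ∈ S)
    (hs : IsSumFunction Y s) : sumSet s ∈ S := by
  have h : {x | ∃ m, m < x + 1 + 1 ∧ pair m x ∈ s} ∈ S :=
    hS.setOf_mem hsS [] (P := fun x _ => ∃ m, m < x + 1 + 1 ∧ pair m x ∈ s)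
      (.bex (.add (.add (.var _) .one) .one) (.mem (.pair (.var _) (.var _))))
  convert h using 1
  ext x
  refine ⟨fun hx => ?_, fun ⟨m, _, h⟩ => ⟨m, h⟩⟩
  obtain ⟨m, hm, hmin⟩ := hS.exists_isLeast
    (hS.setOf_mem hsS [x] (P := fun m v => pair m (v 0) ∈ s) (.mem (.pair (.var _) (.var _)))) hx
  refine ⟨m, hS.lt_add_one_iff.2 ?_, hm⟩
  obtain rfl | ⟨n, rfl⟩ := hS.eq_zero_or_succ m
  · exact zero_le
  obtain ⟨p, hp, -⟩ := hs.1.2 n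
  by_cases hn : n ∈ Y
  · have := hs.1.unique hm ((hs.2.2 n p hp).1 hn)
    change x = p + n at this
    rw [this]
    exact add_le_add_left le_add_self 1
  · obtain rfl : x = p := hs.1.unique hm ((hs.2.2 n p hp).2 hn)
    exact absurd (hmin hp) (not_le.2 (hS.lt_add_one_iff.2 le_rfl))

theorem IsSumFunction.exists_of_mem_sumSet (hS : IsModelRCA0 S) {Y s : Set M} (hYS : Y ∈ S)
    (hu : Unbounded Y) (hsS : s ∈ S) (hs : IsSumFunction Y s) {x : M} (hx : x ∈ sumSet s) :
    ∃ y ∈ Y, pair y x ∈ s := by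
  obtain ⟨m, hm⟩ := hx
  by_cases hmY : m ∈ Y
  · exact ⟨m, hmY, hm⟩
  obtain ⟨y, hy, hmin⟩ := hS.exists_isLeast_gt hYS hu m
  exact ⟨y, hy.1, hs.eq_of_disjoint hS hsS hy.2.le hm fun z hz hmz =>
    hmin ⟨hz, lt_of_le_of_ne hmz fun h => hmY (h ▸ hz)⟩⟩

theorem IsSumFunction.unbounded_sumSet {Y s : Set M} (hu : Unbounded Y) (hs : IsSumFunction Y s) :
    Unbounded (sumSet s) := by
  intro m
  obtain ⟨y, hy, hmy⟩ := hu m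
  obtain ⟨p, hp, -⟩ := hs.1.2 y
  exact ⟨p + y, ⟨y + 1, (hs.2.2 y p hp).1 hy⟩, hmy.trans_le le_add_self⟩

/-- The gap of `sumSet s` after the sum of the elements below `y ∈ Y` is `y`. -/
theorem IsSumFunction.eq_add_of_consecutive (hS : IsModelRCA0 S) {Y s : Set M} (hsS : s ∈ S)
    (hs : IsSumFunction Y s) {a b y : M} (hy : y ∈ Y) (hy0 : 0 < y) (ha : pair y a ∈ s)
    (hab : Consecutive (sumSet s) a b) : b = a + y := by
  have h₁ := (hs.2.2 y a ha).1 hy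
  obtain ⟨-, ⟨m, hm⟩, hlt, hmin⟩ := hab
  have h₂ := hmin _ ⟨_, h₁⟩
  have h₃ : a < a + y := lt_add_of_pos_right a hy0
  refine le_antisymm (not_lt.1 fun h => h₂ ⟨h₃, h⟩) ?_
  -- `b` is the value of `s` at `m`. If `y < m`, monotonicity puts it above the value `a + y` at `y
  -- + 1`; if `m ≤ y`, it would be at most `a`.
  rcases lt_or_ge y m with hmy | hmy
  · exact hs.monotone hS hsS (hS.add_one_le_iff.2 hmy) h₁ hm
  · exact absurd (hs.monotone hS hsS hmy hm ha) hlt.not_ge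

theorem IsSumFunction.separated_sumSet (hS : IsModelRCA0 S) {Y s : Set M} (hYS : Y ∈ S)
    (hu : Unbounded Y) (hap : Apart S Y) (hsS : s ∈ S) (hs : IsSumFunction Y s) :
    Separated S (sumSet s) := by
  intro a b c hab hbc
  obtain ⟨y, hy, hya⟩ := hs.exists_of_mem_sumSet hS hYS hu hsS hab.1
  obtain ⟨z, hyz⟩ := hS.exists_consecutive hYS hu hy
  have hmu := hap y z hyz
  obtain ⟨hy0, -⟩ := hmu.pos_and_lt hS
  have hb := hs.eq_add_of_consecutive hS hsS hy hy0 hya hab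
  -- `b` is the value of `s` at `y + 1`, hence also at `z`, as `Y` has no elements between `y` and
  -- `z`.
  have hzb : pair z b ∈ s := by
    rw [hb]
    refine hs.eq_of_disjoint hS hsS (hS.add_one_le_iff.2 hyz.2.2.1) ((hs.2.2 y a hya).1 hy) ?_
    exact fun x hx h => not_lt.1 fun h' => hyz.2.2.2 x hx ⟨hS.add_one_le_iff.1 h, h'⟩
  exact ⟨y, z, hb, hs.eq_add_of_consecutive hS hsS hyz.2.1 (hy0.trans hyz.2.2.1) hzb hbc, hmu⟩

/-- `M` has no subtraction, so differences are given as a tuple `v` satisfying this equation. -/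
theorem increasing_iff {n : ℕ} {x : Fin (n + 1) → M} {v : Fin n → M}
    (h : ∀ i, x i.succ = x i.castSucc + v i) : Increasing x ↔ ∀ i, v i ≠ 0 := by
  have : Increasing x ↔ StrictMono x := ⟨fun h i j hij => h i j hij, fun h i j hij => h hij⟩
  rw [this, Fin.strictMono_iff_lt_succ]
  refine forall_congr' fun i => ?_
  rw [h, lt_add_iff_pos_right, pos_iff_ne_zero]

theorem Increasing.exists_differences {d : ℕ} {x : Fin (d + 1) → M} (hx : Increasing x) :
    ∃ v : Fin d → M, ∀ i, x i.succ = x i.castSucc + v i := by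
  choose v hv using fun j : Fin d => exists_add_of_le (hx _ _ (Fin.castSucc_lt_succ (i := j))).le
  exact ⟨v, hv⟩

theorem increasing_partialSum {n : ℕ} {v : Fin n → M} :
    Increasing (Fin.partialSum v) ↔ ∀ i, v i ≠ 0 :=
  increasing_iff fun i => Fin.partialSum_succ v i

/-- A tuple is thus a translate of the partial sums of its differences, which is where
`ℤ`-invariance applies. -/
theorem eq_partialSum_add {n : ℕ} {x : Fin (n + 1) → M} {v : Fin n → M}
    (h : ∀ i, x i.succ = x i.castSucc + v i) (i : Fin (n + 1)) :
    x i = Fin.partialSum v i + x 0 := by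
  induction i using Fin.induction with
  | zero => simp
  | succ i ih => rw [h, ih, Fin.partialSum_succ, add_right_comm]

theorem TermDef.partialSum {n : ℕ} {x : Fin n → (ℕ → M) → M} (hx : ∀ i, TermDef (x i))
    (i : Fin (n + 1)) : TermDef fun v => Fin.partialSum (fun i => x i v) i := by
  induction i using Fin.induction with
  | zero => simpa using TermDef.zero
  | succ i ih => simpa [Fin.partialSum_succ] using ih.add (hx i)

theorem IsColouring.lt {n : ℕ} {D : (Fin n → M) → Prop} {C : Set M} {k : M}
    (hS : IsModelRCA0 S) (hC : IsColouring D C k) {x : Fin n → M} {j : M}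
    (h : pair (tuple x) j ∈ C) : j < k := by
  obtain ⟨y, i, -, hi, heq⟩ := hC.1 _ h
  rwa [(hS.pair_inj.1 heq).2]

/-- The colouring of `d`-tuples that maps `v` to the colour of the set of the partial sums of `v`,
and to `0` if `v` has an entry `0`. -/
def sumColouring (d : ℕ) (C : Set M) : Set M :=
  {w | ∃ j, ∃ v : Fin d → M, w = pair (tuple v) j ∧
    ((∀ i, v i ≠ 0) ∧ pair (tuple (Fin.partialSum v)) j ∈ C ∨ (¬ ∀ i, v i ≠ 0) ∧ j = 0)}

theorem pair_mem_sumColouring (hS : IsModelRCA0 S) {d : ℕ} {C : Set M} {v : Fin d → M} {j : M} :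
    pair (tuple v) j ∈ sumColouring d C ↔
      (∀ i, v i ≠ 0) ∧ pair (tuple (Fin.partialSum v)) j ∈ C ∨ (¬ ∀ i, v i ≠ 0) ∧ j = 0 := by
  constructor
  · rintro ⟨i, w, hw, h⟩
    obtain ⟨h₁, rfl⟩ := hS.pair_inj.1 hw
    obtain rfl := hS.tuple_injective h₁
    exact h
  · exact fun h => ⟨j, v, rfl, h⟩

theorem sumColouring_mem (hS : IsModelRCA0 S) (d : ℕ) {C : Set M} (hC : C ∈ S) :
    sumColouring d C ∈ S := by
  have h : {w | ∃ j, j < w + 1 ∧ ∃ v : Fin d → M, (∀ i, v i < w + 1) ∧ (w = pair (tuple v) j ∧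
      ((∀ i, v i ≠ 0) ∧ pair (tuple (Fin.partialSum v)) j ∈ C ∨
        (¬ ∀ i, v i ≠ 0) ∧ j = 0))} ∈ S :=
    hS.setOf_mem hC [] (P := fun w _ => ∃ j, j < w + 1 ∧ ∃ v : Fin d → M, (∀ i, v i < w + 1) ∧
        (w = pair (tuple v) j ∧ ((∀ i, v i ≠ 0) ∧ pair (tuple (Fin.partialSum v)) j ∈ C ∨
          (¬ ∀ i, v i ≠ 0) ∧ j = 0)))
      -- In scope are `j`, the idle witness of `setOf_mem`, and `w`, which therefore has index `2`.
      (.bex (.add (.var _) .one) (.bex_fin (m := 2)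
        (.and (.eq (.var _) (.pair (.tuple fun i => .var _) (.var _)))
          (.or (.and (.forall_fin fun i => .not (.eq (.var _) .zero))
            (.mem (.pair (.tuple (.partialSum fun i => .var i)) (.var _))))
            (.and (.not (.forall_fin fun i => .not (.eq (.var _) .zero))) (.eq (.var _) .zero))))))
  convert h using 1
  ext w
  constructor
  · rintro ⟨j, v, rfl, h⟩
    exact ⟨j, hS.lt_add_one_iff.2 (hS.right_le_pair _ _), v,
      fun i => hS.lt_add_one_iff.2 ((hS.le_tuple v i).trans (left_le_pair _ _)), rfl, h⟩
  · rintro ⟨j, -, v, -, h⟩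
    exact ⟨j, v, h⟩

/-- The bound `k + 1` leaves room for the default colour `0` without a proof of `0 < k`. -/
theorem isColouring_sumColouring (hS : IsModelRCA0 S) {d : ℕ} {C : Set M} {k : M}
    (hC : IsColouring (fun x : Fin (d + 1) → M => Increasing x) C k) :
    IsColouring (fun _ : Fin d → M => True) (sumColouring d C) (k + 1) := by
  constructor
  · rintro _ ⟨j, v, rfl, h⟩
    refine ⟨v, j, trivial, ?_, rfl⟩
    rcases h with ⟨-, h⟩ | ⟨-, rfl⟩
    · exact hS.lt_add_one_iff.2 (hC.lt hS h).le
    · exact hS.lt_add_one_iff.2 zero_le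
  · intro v _
    simp only [pair_mem_sumColouring hS]
    by_cases hv : ∀ i, v i ≠ 0
    · simpa [hv] using hC.2 _ (increasing_partialSum.2 hv)
    · simp [hv]

theorem satSepZRT_of_satApAHT (hS : IsModelRCA0 S) {d : ℕ} (h : SatApAHT d S) :
    SatSepZRT (d + 1) S := by
  intro k C hCS hC hZ
  obtain ⟨Y, hYS, hu, hap, s, hsS, hs, i, hi⟩ :=
    h (k + 1) _ (sumColouring_mem hS d hCS) (isColouring_sumColouring hS hC)
  refine ⟨sumSet s, hs.sumSet_mem hS hsS, hs.unbounded_sumSet hu,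
    hs.separated_sumSet hS hYS hu hap hsS, i, fun x hx hxs => ?_⟩
  -- `x j` is the sum of the elements of `Y` below `y j`, so the `y j` witness that the differences
  -- of `x` are adjacent sums.
  choose y hyY hys using fun j => hs.exists_of_mem_sumSet hS hYS hu hsS (hxs j)
  obtain ⟨z, hz⟩ := hx.exists_differences
  have hAFS : IsAFS d Y s z := by
    refine ⟨y, fun a b hab => ?_, hyY, fun j => ⟨x j.castSucc, hys _, hz j ▸ hys _⟩⟩
    exact not_le.1 fun hba => (hx a b hab).not_ge (hs.monotone hS hsS hba (hys _) (hys _))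
  rcases (pair_mem_sumColouring hS).1 (hi z hAFS) with ⟨hz0, hC'⟩ | ⟨hz0, -⟩
  · rw [hZ _ (increasing_partialSum.2 hz0) (x 0)] at hC'
    rwa [funext (eq_partialSum_add hz)]
  · exact absurd ((increasing_iff hz).1 hx) hz0

end SumSets

end SecondOrderArith

/-! ## From the `ℤ`-Ramsey theorem to the adjacent Hindman theorem -/

namespace SecondOrderArith

section GapSets

variable {M : Type u} [CommSemiring M] [LinearOrder M] [IsStrictOrderedRing M]
  [CanonicallyOrderedAdd M] {S : Set (Set M)}

/-- There is no element of `X` in the open interval from `a` to `a + m`. -/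
def GapGE (X : Set M) (a m : M) : Prop := ∀ c, c < a + m → c ∈ X → c ≤ a

/-- The set of the differences of consecutive elements. -/
def gapSet (X : Set M) : Set M := {y | ∃ a, Consecutive X a (a + y)}

/-- `X` is an infinite set whose gaps increase. -/
structure HasIncreasingGaps (S : Set (Set M)) (X : Set M) : Prop where
  mem : X ∈ S
  unbounded : Unbounded X
  gap_lt_gap : ∀ a p q, Consecutive X a (a + p) → Consecutive X (a + p) (a + p + q) → p < q

/-- The quantifier over all of `X` is replaced by one below `a + y`, so that consecutiveness becomes
a bounded formula. -/
theorem consecutive_add_iff {X : Set M} {a y : M} :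
    Consecutive X a (a + y) ↔ a ∈ X ∧ a + y ∈ X ∧ a < a + y ∧ GapGE X a y := by
  refine and_congr_right fun _ => and_congr_right fun _ => and_congr_right fun _ => ?_
  exact ⟨fun h c hc hcX => not_lt.1 fun hac => h c hcX ⟨hac, hc⟩,
    fun h c hcX hc => (h c hc.2 hcX).not_gt hc.1⟩

/-- The length of the gap after `a` can thus be compared with `m` by a bounded formula that does not
mention the gap. -/
theorem Consecutive.gapGE_iff {X : Set M} {a y m : M} (h : Consecutive X a (a + y)) :
    GapGE X a m ↔ m ≤ y := by
  constructor
  · exact fun hm => not_lt.1 fun hlt => (hm _ (add_lt_add_right hlt a) h.2.1).not_gt h.2.2.1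
  · exact fun hm c hc => (consecutive_add_iff.1 h).2.2.2 c (hc.trans_le (add_le_add_right hm a))

theorem Consecutive.exists_add {X : Set M} {a b : M} (h : Consecutive X a b) :
    ∃ y, b = a + y := exists_add_of_le h.2.2.1.le

theorem Consecutive.le_of_lt {X : Set M} {a b c : M} (h : Consecutive X a b) (hc : c ∈ X)
    (hac : a < c) : b ≤ c := not_lt.1 fun hcb => h.2.2.2 c hc ⟨hac, hcb⟩

/-- `hs'` is the term `s` once more, under the bound variable inside `GapGE`. -/
theorem BoundedDef.gapGE {X : Set M} {s t : (ℕ → M) → M} (hs : TermDef s) (ht : TermDef t)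
    (hs' : TermDef fun v => s fun n => v (n + 1)) :
    BoundedDef X fun v => GapGE X (s v) (t v) :=
  .ball (.add hs ht) (.imp (.mem (.var 0)) (.le (.var 0) hs'))

theorem BoundedDef.consecutive_add {X : Set M} {s t : (ℕ → M) → M} (hs : TermDef s)
    (ht : TermDef t) (hs' : TermDef fun v => s fun n => v (n + 1)) :
    BoundedDef X fun v => Consecutive X (s v) (s v + t v) :=
  BoundedDef.congr (.and (.mem hs) (.and (.mem (.add hs ht)) (.and (.lt hs (.add hs ht))
    (.gapGE hs ht hs')))) fun _ => consecutive_add_iff.symm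

namespace HasIncreasingGaps

variable {X : Set M}

theorem exists_gap (hS : IsModelRCA0 S) (hX : HasIncreasingGaps S X) {a : M} (ha : a ∈ X) :
    ∃ y, Consecutive X a (a + y) := by
  obtain ⟨b, hb⟩ := hS.exists_consecutive hX.mem hX.unbounded ha
  obtain ⟨y, rfl⟩ := hb.exists_add
  exact ⟨y, hb⟩

/-- By hypothesis only adjacent gaps compare. If the claim fails, let `e` be the least element of
`X` above `a` whose gap is at most `y`. The gap ending at `e` is either the one at `a` or, by
minimality, longer than `y`; in both cases the gap at `e` is longer still. -/
theorem gap_lt (hS : IsModelRCA0 S) (hX : HasIncreasingGaps S X) {a b y z : M}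
    (ha : Consecutive X a (a + y)) (hb : Consecutive X b (b + z)) (hab : a < b) : y < z := by
  by_contra! hzy
  obtain ⟨e, ⟨heX, hae, heg⟩, hmin⟩ := hS.exists_isLeast
    (hS.setOf_mem hX.mem [a, y] (P := fun x v => x ∈ X ∧ v 0 < x ∧ ¬ GapGE X x (v 1 + 1))
      (.and (.mem (.var _)) (.and (.lt (.var _) (.var _))
        (.not (.gapGE (.var _) (.add (.var _) .one) (.var _))))))
    ⟨b, hb.1, hab, fun h => (hS.lt_add_one_iff.2 le_rfl).not_ge ((hb.gapGE_iff.1 h).trans hzy)⟩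
  change ¬ GapGE X e (y + 1) at heg
  obtain ⟨w, hw⟩ := hX.exists_gap hS heX
  rw [hw.gapGE_iff, not_le, hS.lt_add_one_iff] at heg
  rcases (ha.le_of_lt heX hae).eq_or_lt with rfl | hlt
  · exact (hX.gap_lt_gap a y w ha hw).not_ge heg
  · obtain ⟨c, hc, hce⟩ := hS.exists_consecutive_of_lt hX.mem ha.2.1 heX hlt
    obtain ⟨u, rfl⟩ := hce.exists_add
    have huw := hX.gap_lt_gap c u w hce hw
    refine hce.2.2.1.not_ge (hmin ⟨hce.1, ha.2.2.1.trans_le hc, fun h => ?_⟩)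
    have : y + 1 ≤ u := hce.gapGE_iff.1 h
    exact ((hS.add_one_le_iff.1 this).trans huw).not_ge heg

theorem lt_of_gap_lt (hS : IsModelRCA0 S) (hX : HasIncreasingGaps S X) {a b y z : M}
    (ha : Consecutive X a (a + y)) (hb : Consecutive X b (b + z)) (hyz : y < z) : a < b := by
  rcases lt_trichotomy a b with h | rfl | h
  · exact h
  · exact absurd (ha.gapGE_iff.1 (hb.gapGE_iff.2 le_rfl)) hyz.not_ge
  · exact absurd (hX.gap_lt hS hb ha h) hyz.not_gt

theorem exists_gapGE (hS : IsModelRCA0 S) (hX : HasIncreasingGaps S X) (m : M) :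
    ∃ a, a ∈ X ∧ GapGE X a m := by
  refine hS.induction_exists hX.mem [] (P := fun a m _ => a ∈ X ∧ GapGE X a m)
    (.and (.mem (.var _)) (.gapGE (.var _) (.var _) (.var _))) ?_ ?_ m
  · obtain ⟨a, ha, -⟩ := hX.unbounded 0
    exact ⟨a, ha, fun c hc _ => hc.le.trans_eq (add_zero a)⟩
  · rintro m ⟨a, ha, hm⟩
    obtain ⟨y, hy⟩ := hX.exists_gap hS ha
    obtain ⟨z, hz⟩ := hX.exists_gap hS hy.2.1
    refine ⟨a + y, hy.2.1, hz.gapGE_iff.2 (hS.add_one_le_iff.2 ?_)⟩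
    exact (hy.gapGE_iff.1 hm).trans_lt (hX.gap_lt hS hy hz hy.2.2.1)

theorem unbounded_gapSet (hS : IsModelRCA0 S) (hX : HasIncreasingGaps S X) :
    Unbounded (gapSet X) := by
  intro m
  obtain ⟨a, ha, hm⟩ := hX.exists_gapGE hS (m + 1)
  obtain ⟨y, hy⟩ := hX.exists_gap hS ha
  exact ⟨y, ⟨a, hy⟩, hS.add_one_le_iff.1 (hy.gapGE_iff.1 hm)⟩

/-- The `Σ⁰₁` form is the definition. For the `Π⁰₁` form: every `a ∈ X` with a gap longer than `y`
lies to the right of any gap `y`, so `y` must occur below each such `a`; conversely, such an `a`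
exists. -/
theorem gapSet_mem (hS : IsModelRCA0 S) (hX : HasIncreasingGaps S X) : gapSet X ∈ S := by
  refine hS.setOf_mem_of_iff hX.mem [] (P := fun a y _ => Consecutive X a (a + y))
    (Q := fun a y _ => a ∈ X ∧ GapGE X a (y + 1) → ∃ b, b < a ∧ Consecutive X b (b + y))
    (.consecutive_add (.var _) (.var _) (.var _))
    (.imp (.and (.mem (.var _)) (.gapGE (.var _) (.add (.var _) .one) (.var _)))
      (.bex (.var _) (.consecutive_add (.var _) (.var _) (.var _)))) (fun y => Iff.rfl) fun y => ?_
  constructor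
  · rintro ⟨b, hb⟩ a ⟨ha, hay⟩
    obtain ⟨z, hz⟩ := hX.exists_gap hS ha
    exact ⟨b, hX.lt_of_gap_lt hS hb hz (hS.add_one_le_iff.1 (hz.gapGE_iff.1 hay)), hb⟩
  · intro h
    obtain ⟨a, ha⟩ := hX.exists_gapGE hS (y + 1)
    obtain ⟨b, -, hb⟩ := h a ha
    exact ⟨b, hb⟩

/-- Consecutive elements of `gapSet X` are the differences of three consecutive elements. -/
theorem consecutive_gapSet (hS : IsModelRCA0 S) (hX : HasIncreasingGaps S X) {y z : M}
    (h : Consecutive (gapSet X) y z) :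
    ∃ a, Consecutive X a (a + y) ∧ Consecutive X (a + y) (a + y + z) := by
  obtain ⟨⟨a, ha⟩, ⟨b, hb⟩, hyz, hmin⟩ := h
  refine ⟨a, ha, ?_⟩
  rcases (ha.le_of_lt hb.1 (hX.lt_of_gap_lt hS ha hb hyz)).eq_or_lt with rfl | hlt
  · exact hb
  · obtain ⟨w, hw⟩ := hX.exists_gap hS ha.2.1
    -- Otherwise the gap `w` after `a + y` would lie strictly between `y` and `z`.
    exact absurd ⟨hX.gap_lt hS ha hw ha.2.2.1, hX.gap_lt hS hw hb hlt⟩ (hmin w ⟨_, hw⟩)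

end HasIncreasingGaps

/-- The function that maps `m` to the difference between the least `a ∈ X` that is followed by a
gap of length at least `m`, and `x₀`. -/
def gapSum (X : Set M) (x₀ : M) : Set M :=
  {w | ∃ m p, w = pair m p ∧ IsLeast {a ∈ X | GapGE X a m} (x₀ + p)}

theorem pair_mem_gapSum (hS : IsModelRCA0 S) {X : Set M} {x₀ m p : M} :
    pair m p ∈ gapSum X x₀ ↔ IsLeast {a ∈ X | GapGE X a m} (x₀ + p) := by
  constructor
  · rintro ⟨m', p', heq, h⟩
    obtain ⟨rfl, rfl⟩ := hS.pair_inj.1 heq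
    exact h
  · exact fun h => ⟨m, p, rfl, h⟩

theorem gapSum_mem (hS : IsModelRCA0 S) {X : Set M} (hX : X ∈ S) (x₀ : M) :
    gapSum X x₀ ∈ S := by
  have h : {w | ∃ m, m < w + 1 ∧ ∃ p, p < w + 1 ∧ (w = pair m p ∧
      (x₀ + p ∈ X ∧ GapGE X (x₀ + p) m) ∧ ∀ a, a < x₀ + p → ¬ (a ∈ X ∧ GapGE X a m))} ∈ S :=
    hS.setOf_mem hX [x₀] (P := fun w v => ∃ m, m < w + 1 ∧ ∃ p, p < w + 1 ∧ (w = pair m p ∧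
      (v 0 + p ∈ X ∧ GapGE X (v 0 + p) m) ∧ ∀ a, a < v 0 + p → ¬ (a ∈ X ∧ GapGE X a m)))
      (.bex (.add (.var _) .one) (.bex (.add (.var _) .one)
        (.and (.eq (.var _) (.pair (.var _) (.var _)))
          (.and (.and (.mem (.add (.var _) (.var _)))
              (.gapGE (.add (.var _) (.var _)) (.var _) (.add (.var _) (.var _))))
            (.ball (.add (.var _) (.var _))
              (.not (.and (.mem (.var _)) (.gapGE (.var _) (.var _) (.var _)))))))))
  convert h using 1
  ext w
  constructor
  · rintro ⟨m, p, rfl, h, hmin⟩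
    exact ⟨m, hS.lt_add_one_iff.2 (left_le_pair _ _), p,
      hS.lt_add_one_iff.2 (hS.right_le_pair _ _), rfl, h, fun a ha h' => (hmin h').not_gt ha⟩
  · rintro ⟨m, -, p, -, rfl, h, hmin⟩
    exact ⟨m, p, rfl, h, fun a ha => not_lt.1 fun hlt => hmin a hlt ha⟩

theorem HasIncreasingGaps.isLeast_gapGE (hS : IsModelRCA0 S) {X : Set M}
    (hX : HasIncreasingGaps S X) {a y : M} (h : Consecutive X a (a + y)) :
    IsLeast {a ∈ X | GapGE X a y} a := by
  refine ⟨⟨h.1, h.gapGE_iff.2 le_rfl⟩, fun b ⟨hb, hby⟩ => not_lt.1 fun hba => ?_⟩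
  obtain ⟨z, hz⟩ := hX.exists_gap hS hb
  exact (hX.gap_lt hS hz h hba).not_ge (hz.gapGE_iff.1 hby)

/-- The gaps smaller than `m` are those to the left of the first `a` with a gap of at least `m`, and
they telescope to `a - x₀`. Passing from `m` to `m + 1` moves `a` to `a + m` if `m` is a gap, and
leaves it in place otherwise. -/
theorem HasIncreasingGaps.isSumFunction (hS : IsModelRCA0 S) {X : Set M}
    (hX : HasIncreasingGaps S X) {x₀ : M} (hx₀ : IsLeast X x₀) :
    IsSumFunction (gapSet X) (gapSum X x₀) := by
  refine ⟨⟨?_, fun m => ?_⟩, ?_, fun m p hm => ⟨fun hmY => ?_, fun hmY => ?_⟩⟩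
  · rintro _ ⟨m, p, rfl, -⟩
    exact ⟨m, p, rfl⟩
  · obtain ⟨a, ha⟩ := hS.exists_isLeast (hS.setOf_mem hX.mem [m]
      (P := fun a v => a ∈ X ∧ GapGE X a (v 0))
      (.and (.mem (.var _)) (.gapGE (.var _) (.var _) (.var _)))) (hX.exists_gapGE hS m)
    obtain ⟨p, rfl⟩ := exists_add_of_le (hx₀.2 ha.1.1)
    refine ⟨p, (pair_mem_gapSum hS).2 ha, fun q hq => ?_⟩
    exact add_left_cancel (((pair_mem_gapSum hS).1 hq).unique ha)
  · rw [pair_mem_gapSum hS, add_zero]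
    exact ⟨⟨hx₀.1, fun c hc _ => hc.le.trans_eq (add_zero _)⟩, fun a ha => hx₀.2 ha.1⟩
  · rw [pair_mem_gapSum hS] at hm ⊢
    obtain ⟨a, ha⟩ := hmY
    obtain rfl := (hX.isLeast_gapGE hS ha).unique hm
    rw [← add_assoc]
    obtain ⟨z, hz⟩ := hX.exists_gap hS ha.2.1
    refine ⟨⟨ha.2.1, hz.gapGE_iff.2 (hS.add_one_le_iff.2 (hX.gap_lt hS ha hz ha.2.2.1))⟩, ?_⟩
    rintro b ⟨hb, hbm⟩
    obtain ⟨w, hw⟩ := hX.exists_gap hS hb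
    exact ha.le_of_lt hb (hX.lt_of_gap_lt hS ha hw (hS.add_one_le_iff.1 (hw.gapGE_iff.1 hbm)))
  · rw [pair_mem_gapSum hS] at hm ⊢
    have hle : m ≤ m + 1 := le_self_add
    obtain ⟨y, hy⟩ := hX.exists_gap hS hm.1.1
    refine ⟨⟨hm.1.1, hy.gapGE_iff.2 (hS.add_one_le_iff.2 ?_)⟩, fun b ⟨hb, hbm⟩ => hm.2 ⟨hb, ?_⟩⟩
    · refine lt_of_le_of_ne (hy.gapGE_iff.1 hm.1.2) ?_
      rintro rfl
      exact hmY ⟨_, hy⟩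
    · exact fun c hc => hbm c (hc.trans_le (add_le_add_right hle b))

/-- The colouring of increasing `d + 1`-tuples that maps `x` to the colour of the tuple of its
successive differences. -/
def diffColouring (d : ℕ) (C : Set M) : Set M :=
  {w | ∃ j, ∃ x : Fin (d + 1) → M, ∃ v : Fin d → M, (w = pair (tuple x) j ∧
    (∀ i, x i.succ = x i.castSucc + v i) ∧ (∀ i, v i ≠ 0) ∧ pair (tuple v) j ∈ C)}

theorem pair_mem_diffColouring (hS : IsModelRCA0 S) {d : ℕ} {C : Set M} {x : Fin (d + 1) → M}
    {v : Fin d → M} (hx : ∀ i, x i.succ = x i.castSucc + v i) {j : M} :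
    pair (tuple x) j ∈ diffColouring d C ↔ Increasing x ∧ pair (tuple v) j ∈ C := by
  rw [increasing_iff hx]
  constructor
  · rintro ⟨i, y, u, heq, hy, h⟩
    obtain ⟨h₁, rfl⟩ := hS.pair_inj.1 heq
    obtain rfl := hS.tuple_injective h₁
    obtain rfl : v = u := funext fun i => add_left_cancel ((hx i).symm.trans (hy i))
    exact h
  · exact fun h => ⟨j, x, v, rfl, hx, h⟩

theorem diffColouring_mem (hS : IsModelRCA0 S) (d : ℕ) {C : Set M} (hC : C ∈ S) :
    diffColouring d C ∈ S := by
  have h : {w | ∃ j, j < w + 1 ∧ ∃ x : Fin (d + 1) → M, (∀ i, x i < w + 1) ∧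
      ∃ v : Fin d → M, (∀ i, v i < w + 1) ∧ (w = pair (tuple x) j ∧
        (∀ i, x i.succ = x i.castSucc + v i) ∧ (∀ i, v i ≠ 0) ∧ pair (tuple v) j ∈ C)} ∈ S :=
    hS.setOf_mem hC [] (P := fun w _ => ∃ j, j < w + 1 ∧ ∃ x : Fin (d + 1) → M,
        (∀ i, x i < w + 1) ∧ ∃ v : Fin d → M, (∀ i, v i < w + 1) ∧ (w = pair (tuple x) j ∧
          (∀ i, x i.succ = x i.castSucc + v i) ∧ (∀ i, v i ≠ 0) ∧ pair (tuple v) j ∈ C))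
      -- The `d + 1` entries of `x` move `w` from index `2` to `2 + (d + 1)`.
      (.bex (.add (.var _) .one) (.bex_fin (m := 2) (.bex_fin (m := 2 + (d + 1))
        (.and (.eq (.var _) (.pair (.tuple fun i => .var _) (.var _)))
          (.and (.forall_fin fun i => .eq (.var _) (.add (.var _) (.var _)))
            (.and (.forall_fin fun i => .not (.eq (.var _) .zero))
              (.mem (.pair (.tuple fun i => .var _) (.var _)))))))))
  convert h using 1
  ext w
  constructor
  · rintro ⟨j, x, v, rfl, hx, h⟩
    have hxle : ∀ i, x i ≤ pair (tuple x) j := fun i => (hS.le_tuple x i).trans (left_le_pair _ _)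
    refine ⟨j, hS.lt_add_one_iff.2 (hS.right_le_pair _ _), x,
      fun i => hS.lt_add_one_iff.2 (hxle i), v, fun i => hS.lt_add_one_iff.2 ?_, rfl, hx, h⟩
    exact (le_add_self.trans_eq (hx i).symm).trans (hxle _)
  · rintro ⟨j, -, x, -, v, -, h⟩
    exact ⟨j, x, v, h⟩

theorem isColouring_diffColouring (hS : IsModelRCA0 S) {d : ℕ} {C : Set M} {k : M}
    (hC : IsColouring (fun _ : Fin d → M => True) C k) :
    IsColouring (fun x : Fin (d + 1) → M => Increasing x) (diffColouring d C) k := by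
  constructor
  · rintro _ ⟨j, x, v, rfl, hx, hv, h⟩
    exact ⟨x, j, (increasing_iff hx).2 hv, hC.lt hS h, rfl⟩
  · intro x hx
    obtain ⟨v, hv⟩ := hx.exists_differences
    simpa [pair_mem_diffColouring hS hv, hx] using hC.2 v trivial

theorem zInvariant_diffColouring (hS : IsModelRCA0 S) (d : ℕ) (C : Set M) :
    ZInvariant (d + 1) (diffColouring d C) := by
  intro x hx z j
  obtain ⟨v, hv⟩ := hx.exists_differences
  have hv' : ∀ i, x i.succ + z = x i.castSucc + z + v i := fun i => by
    rw [hv, add_right_comm]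
  rw [pair_mem_diffColouring hS hv,
    pair_mem_diffColouring hS (x := fun i => x i + z) hv', increasing_iff hv,
    increasing_iff (x := fun i => x i + z) hv']

theorem Separated.hasIncreasingGaps (hS : IsModelRCA0 S) {X : Set M} (hX : X ∈ S)
    (hu : Unbounded X) (h : Separated S X) : HasIncreasingGaps S X := by
  refine ⟨hX, hu, fun a p q hp hq => ?_⟩
  obtain ⟨p', q', hp', hq', hmu⟩ := h _ _ _ hp hq
  rw [add_left_cancel hp', add_left_cancel hq']
  exact (hmu.pos_and_lt hS).2

theorem satApAHT_of_satSepZRT (hS : IsModelRCA0 S) {d : ℕ} (h : SatSepZRT (d + 1) S) :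
    SatApAHT d S := by
  intro k C hCS hC
  obtain ⟨X, hXS, hu, hsep, i, hi⟩ := h k _ (diffColouring_mem hS d hCS)
    (isColouring_diffColouring hS hC) (zInvariant_diffColouring hS d C)
  have hX := hsep.hasIncreasingGaps hS hXS hu
  obtain ⟨x₀, hx₀⟩ := hS.exists_isLeast hXS ((hu 0).imp fun _ h => h.1)
  have hsum := hX.isSumFunction hS hx₀
  refine ⟨gapSet X, hX.gapSet_mem hS, hX.unbounded_gapSet hS, fun y z hyz => ?_, gapSum X x₀,
    gapSum_mem hS hXS x₀, hsum, i, ?_⟩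
  · obtain ⟨a, hy, hz⟩ := hX.consecutive_gapSet hS hyz
    obtain ⟨p, q, hp, hq, hmu⟩ := hsep _ _ _ hy hz
    rwa [add_left_cancel hp, add_left_cancel hq]
  · rintro z ⟨m, hm, hmY, hz⟩
    -- `x j` is the element of `X` followed by the gap `m j`. The sum function at `m j` is `x j -
    -- x₀`, so the entries of `z` are the differences of `x`.
    choose x hx using hmY
    have hxs : ∀ j p, pair (m j) p ∈ gapSum X x₀ → x j = x₀ + p := fun j p hp =>
      (hX.isLeast_gapGE hS (hx j)).unique ((pair_mem_gapSum hS).1 hp)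
    have hxz : ∀ j : Fin d, x j.succ = x j.castSucc + z j := fun j => by
      obtain ⟨p, hp, hp'⟩ := hz j
      rw [hxs _ _ hp, hxs _ _ hp', add_assoc]
    have hxinc : Increasing x := fun a b hab => hX.lt_of_gap_lt hS (hx a) (hx b) (hm a b hab)
    exact ((pair_mem_diffColouring hS hxz).1 (hi x hxinc fun j => (hx j).1)).2

end GapSets

/-- The `ℤ`-Ramsey theorem with separation and the adjacent Hindman theorem with apartness are
equivalent in all models. -/
theorem satSepZRT_iff_satApAHT {M : Type u} [Zero M] [One M] [Add M] [Mul M] [LT M]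
    {S : Set (Set M)} (hS : IsModelRCA0 S) (d : ℕ) : SatSepZRT (d + 1) S ↔ SatApAHT d S := by
  let _ := hS.commSemiring
  let _ := hS.linearOrder
  have := hS.isStrictOrderedRing
  have := hS.canonicallyOrderedAdd
  exact ⟨fun h => satApAHT_of_satSepZRT hS h, fun h => satSepZRT_of_satApAHT hS h⟩

end SecondOrderArith

/-! ## Computable functionals -/

namespace Weihrauch

open Encodable Denumerable

theorem IsTuringFunctional.of_eq {F G : (ℕ → ℕ) → ℕ →. ℕ} (hF : IsTuringFunctional F)
    (h : ∀ X n, F X n = G X n) : IsTuringFunctional G := by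
  obtain rfl : F = G := funext fun X => funext fun n => h X n
  exact hF

/-- The total functional `F` is a Turing functional. -/
def Computes (F : (ℕ → ℕ) → ℕ → ℕ) : Prop :=
  IsTuringFunctional fun X n => Part.some (F X n)

namespace Computes

variable {F G : (ℕ → ℕ) → ℕ → ℕ}

theorem of_eq (hF : Computes F) (h : ∀ X n, F X n = G X n) : Computes G :=
  IsTuringFunctional.of_eq hF fun X n => by rw [h]

theorem pair (hF : Computes F) (hG : Computes G) : Computes fun X n => Nat.pair (F X n) (G X n) := by
  have := IsTuringFunctional.pair hF hG
  simpa [Computes, Seq.seq] using this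

theorem comp (hF : Computes F) (hG : Computes G) : Computes fun X n => F X (G X n) := by
  have := IsTuringFunctional.comp hF hG
  simpa [Computes] using this

theorem prec (hF : Computes F) (hG : Computes G) : Computes fun X n =>
    Nat.rec (F X n.unpair.1) (fun y ih => G X (Nat.pair n.unpair.1 (Nat.pair y ih))) n.unpair.2 := by
  refine IsTuringFunctional.of_eq (IsTuringFunctional.prec hF hG) fun X n => ?_
  dsimp only
  induction n.unpair.2 with
  | zero => rfl
  | succ y ih => simp only [ih]; simp

theorem of_natPrimrec {f : ℕ → ℕ} (hf : Nat.Primrec f) : Computes fun _ n => f n := by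
  induction hf with
  | zero => exact .zero
  | succ => exact .succ
  | left => exact .left
  | right => exact .right
  | pair _ _ hf hg => exact hf.pair hg
  | comp _ _ hf hg => exact hf.comp hg
  | prec _ _ hf hg => exact hf.prec hg

theorem of_primrec {f : ℕ → ℕ} (hf : Primrec f) : Computes fun _ n => f n :=
  of_natPrimrec (Primrec.nat_iff.1 hf)

theorem id : Computes fun _ n => n := of_primrec .id

theorem const (k : ℕ) : Computes fun _ _ => k := of_primrec (.const k)

theorem fst : Computes fun _ n => n.unpair.1 := .left

theorem snd : Computes fun _ n => n.unpair.2 := .right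

theorem oracle (hF : Computes F) : Computes fun X n => X (F X n) :=
  comp (F := fun X n => X n) IsTuringFunctional.oracle hF

theorem of_primrec₂ {f : ℕ → ℕ → ℕ} (hf : Primrec₂ f) (hF : Computes F) (hG : Computes G) :
    Computes fun X n => f (F X n) (G X n) := by
  have h := (of_natPrimrec (Primrec₂.unpaired'.2 hf)).comp (hF.pair hG)
  simpa using h

theorem add (hF : Computes F) (hG : Computes G) : Computes fun X n => F X n + G X n :=
  of_primrec₂ Primrec.nat_add hF hG

theorem sub (hF : Computes F) (hG : Computes G) : Computes fun X n => F X n - G X n :=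
  of_primrec₂ Primrec.nat_sub hF hG

theorem mul (hF : Computes F) (hG : Computes G) : Computes fun X n => F X n * G X n :=
  of_primrec₂ Primrec.nat_mul hF hG

theorem ite_eq (hF : Computes F) (hG : Computes G) :
    Computes fun X n => if F X n = G X n then 1 else 0 :=
  of_primrec₂ (f := fun a b => if a = b then 1 else 0)
    (Primrec.ite Primrec.eq (.const 1) (.const 0)) hF hG

theorem sum_range {H : (ℕ → ℕ) → ℕ → ℕ → ℕ} (hH : Computes fun X n => H X n.unpair.1 n.unpair.2)
    (hG : Computes G) : Computes fun X n => ∑ i ∈ Finset.range (G X n), H X n i := by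
  have h₁ : Computes fun X n => H X n.unpair.1 n.unpair.2.unpair.1 + n.unpair.2.unpair.2 := by
    have := hH.comp (fst.pair (fst.comp snd))
    simp only [Nat.unpair_pair] at this
    exact this.add (snd.comp snd)
  have h := ((const 0).prec h₁).comp (id.pair hG)
  simp only [Nat.unpair_pair] at h
  refine h.of_eq fun X n => ?_
  induction G X n with
  | zero => rfl
  | succ k ih => rw [Finset.sum_range_succ, ← ih]; exact add_comm _ _

/-- Truncation of a bounded sum: the characteristic function of a bounded existential statement. -/
theorem exists_lt {H : (ℕ → ℕ) → ℕ → ℕ → ℕ} (hH : Computes fun X n => H X n.unpair.1 n.unpair.2)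
    (hG : Computes G) {p : (ℕ → ℕ) → ℕ → Prop} [∀ X n, Decidable (p X n)]
    (hp : ∀ X n, p X n ↔ ∃ i < G X n, H X n i ≠ 0) :
    Computes fun X n => if p X n then 1 else 0 := by
  have h := (const 1).sub ((hH.sum_range hG).ite_eq (const 0))
  refine h.of_eq fun X n => ?_
  simp only [Finset.sum_eq_zero_iff, Finset.mem_range]
  by_cases hpn : p X n
  · obtain ⟨i, hi, hne⟩ := (hp X n).1 hpn
    rw [if_pos hpn, if_neg fun h => hne (h i hi)]
  · rw [if_neg hpn, if_pos]
    by_contra! h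
    exact hpn ((hp X n).2 h)

end Computes

/-- Unbounded search for a zero of a total functional. -/
theorem isTuringFunctional_comp_rfind {F G : (ℕ → ℕ) → ℕ → ℕ} (hF : Computes F)
    (hG : Computes G) : IsTuringFunctional fun X n =>
      (Nat.rfind fun i => Part.some (decide (F X (Nat.pair n i) = 0))) >>=
        fun i => Part.some (G X (Nat.pair n i)) := by
  have h := IsTuringFunctional.comp hG (IsTuringFunctional.pair Computes.id
    (IsTuringFunctional.rfind hF))
  refine h.of_eq fun X n => ?_
  simp [Seq.seq]

end Weihrauch

/-! ## Codes of colourings -/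

namespace Weihrauch

open Encodable Denumerable

/-- The set of the values of an increasing tuple. -/
def Subsets.ofStrictMono {n : ℕ} (x : Fin n → ℕ) (hx : StrictMono x) : Subsets n :=
  ⟨Finset.univ.map ⟨x, hx.injective⟩, by simp⟩

theorem Subsets.exists_eq_ofStrictMono {n : ℕ} (s : Subsets n) :
    ∃ (x : Fin n → ℕ) (hx : StrictMono x), s = ofStrictMono x hx := by
  refine ⟨s.1.orderEmbOfFin s.2, (s.1.orderEmbOfFin s.2).strictMono, Subtype.ext ?_⟩
  apply Finset.coe_injective
  simp [ofStrictMono]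

theorem Subsets.coe_ofStrictMono {n : ℕ} (x : Fin n → ℕ) (hx : StrictMono x) :
    ((ofStrictMono x hx).1 : Set ℕ) = Set.range x := by
  simp [ofStrictMono]

theorem Subsets.shift_ofStrictMono {n : ℕ} (x : Fin n → ℕ) (hx : StrictMono x) (z : ℕ) :
    (ofStrictMono x hx).shift z = ofStrictMono (fun i => x i + z) (hx.add_const z) := by
  apply Subtype.ext
  ext a
  simp [ofStrictMono, shift]

theorem Subsets.orderEmbOfFin_ofStrictMono {n : ℕ} (x : Fin n → ℕ) (hx : StrictMono x) :
    ⇑((ofStrictMono x hx).1.orderEmbOfFin (ofStrictMono x hx).2) = x :=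
  (Finset.orderEmbOfFin_unique _ (fun i => by simp [ofStrictMono]) hx).symm

theorem pairwise_ofFn_iff {n : ℕ} {x : Fin n → ℕ} :
    (List.ofFn x).Pairwise (· < ·) ↔ StrictMono x := by
  rw [List.pairwise_ofFn]
  exact Iff.rfl

theorem subsetColouringCode_of_eq_ofFn {n : ℕ} (c : Subsets n → ℕ) {m : ℕ} {x : Fin n → ℕ}
    (hm : ofNat (List ℕ) m = List.ofFn x) (hx : StrictMono x) :
    subsetColouringCode c m = c (.ofStrictMono x hx) := by
  have h : (ofNat (List ℕ) m).Pairwise (· < ·) ∧ (ofNat (List ℕ) m).length = n := by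
    rw [hm]
    exact ⟨pairwise_ofFn_iff.2 hx, by simp⟩
  rw [subsetColouringCode, dif_pos h]
  congr 1
  apply Subtype.ext
  ext a
  simp [Subsets.ofStrictMono, hm, List.mem_ofFn]

theorem tupleColouringCode_of_eq_ofFn {n : ℕ} (c : (Fin n → ℕ) → ℕ) {m : ℕ} {x : Fin n → ℕ}
    (hm : ofNat (List ℕ) m = List.ofFn x) : tupleColouringCode c m = c x := by
  have h : (ofNat (List ℕ) m).length = n := by simp [hm]
  rw [tupleColouringCode, dif_pos h]
  congr 1
  funext i
  simp [hm]

theorem exists_eq_ofFn {l : List ℕ} {n : ℕ} (h : l.length = n) : ∃ x : Fin n → ℕ, l = List.ofFn x :=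
  ⟨fun i => l.get (i.cast h.symm), by subst h; simp⟩

/-- The list of the sums of initial segments, for a list of length `d`. -/
def partialSums (d : ℕ) (l : List ℕ) : List ℕ :=
  (List.range (d + 1)).map fun i => (l.take i).sum

/-- The list of successive differences, for a list of length `d + 1`. -/
def differences (d : ℕ) (l : List ℕ) : List ℕ :=
  (List.range d).map fun i => l.getD (i + 1) 0 - l.getD i 0

theorem partialSums_ofFn {d : ℕ} (v : Fin d → ℕ) :
    partialSums d (List.ofFn v) = List.ofFn (Fin.partialSum v) := by
  refine List.ext_getElem (by simp [partialSums]) fun i h₁ h₂ => ?_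
  rw [List.getElem_ofFn]
  simp [partialSums, Fin.partialSum]

theorem differences_ofFn {d : ℕ} (x : Fin (d + 1) → ℕ) :
    differences d (List.ofFn x) = List.ofFn fun i : Fin d => x i.succ - x i.castSucc := by
  refine List.ext_getElem (by simp [differences]) fun i h₁ h₂ => ?_
  have hi : i < d := by simpa [differences] using h₁
  rw [List.getElem_ofFn]
  simp [differences, -List.ofFn_succ, List.getD_eq_getElem?_getD, hi, hi.le]

theorem primrec_list_sum : Primrec (List.sum : List ℕ → ℕ) :=
  Primrec.list_foldr (f := fun l : List ℕ => l) (g := fun _ => 0) (h := fun _ p => p.1 + p.2)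
    .id (.const 0) (Primrec.nat_add.comp (Primrec.fst.comp .snd) (Primrec.snd.comp .snd))

theorem primrec_list_prod : Primrec (List.prod : List ℕ → ℕ) :=
  Primrec.list_foldr (f := fun l : List ℕ => l) (g := fun _ => 1) (h := fun _ p => p.1 * p.2)
    .id (.const 1) (Primrec.nat_mul.comp (Primrec.fst.comp .snd) (Primrec.snd.comp .snd))

theorem primrec_partialSums (d : ℕ) : Primrec (partialSums d) :=
  Primrec.list_map (.const _)
    (primrec_list_sum.comp (Primrec.list_take.comp .snd .fst))

theorem primrec_differences (d : ℕ) : Primrec (differences d) :=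
  Primrec.list_map (.const _) (Primrec.nat_sub.comp
    ((Primrec.list_getD 0).comp .fst (Primrec.succ.comp .snd)) ((Primrec.list_getD 0).comp .fst .snd))

/-- The product is a primitive recursive test for having no entry `0`. -/
theorem list_prod_ofFn_ne_zero {n : ℕ} {x : Fin n → ℕ} :
    (List.ofFn x).prod ≠ 0 ↔ ∀ i, x i ≠ 0 := by
  simp [List.prod_ofFn, Finset.prod_ne_zero_iff]

/-- Applying the oracle to the code of a primitive recursive function of a list, for the lists of
length `n` on which `g` does not vanish. -/
theorem computes_recode {f : List ℕ → List ℕ} (hf : Primrec f) {g : List ℕ → ℕ} (hg : Primrec g)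
    (n : ℕ) : Computes fun X m =>
      if (ofNat (List ℕ) m).length = n ∧ g (ofNat (List ℕ) m) ≠ 0 then
        X (encode (f (ofNat (List ℕ) m))) else 0 := by
  have hl := Primrec.ofNat (List ℕ)
  -- The conditional becomes a product with `0`-`1` tests; the oracle is total, so consulting it
  -- when a test fails does no harm.
  have h := ((Computes.of_primrec (Primrec.list_length.comp hl)).ite_eq (.const n)).mul
    (((Computes.const 1).sub ((Computes.of_primrec (hg.comp hl)).ite_eq (.const 0))).mul
      (Computes.of_primrec (Primrec.encode.comp (hf.comp hl))).oracle)
  refine h.of_eq fun X m => ?_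
  by_cases h₁ : (ofNat (List ℕ) m).length = n <;> by_cases h₂ : g (ofNat (List ℕ) m) = 0 <;>
    simp [h₁, h₂]

/-- The colouring of tuples that maps `v` to the colour of the set of the partial sums of `v`, and
to `0` if `v` has an entry `0`. -/
def sumColouring {d : ℕ} (c : Subsets (d + 1) → ℕ) (v : Fin d → ℕ) : ℕ :=
  if h : StrictMono (Fin.partialSum v) then c (.ofStrictMono _ h) else 0

/-- The colouring of `d + 1`-sets that maps a set to the colour of the tuple of its successive
differences. -/
def diffColouring {d : ℕ} (c : (Fin d → ℕ) → ℕ) (s : Subsets (d + 1)) : ℕ :=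
  c fun i => s.1.orderEmbOfFin s.2 i.succ - s.1.orderEmbOfFin s.2 i.castSucc

theorem diffColouring_ofStrictMono {d : ℕ} (c : (Fin d → ℕ) → ℕ) {x : Fin (d + 1) → ℕ}
    (hx : StrictMono x) :
    diffColouring c (.ofStrictMono x hx) = c fun i => x i.succ - x i.castSucc := by
  rw [diffColouring, Subsets.orderEmbOfFin_ofStrictMono]

theorem zInvariant_diffColouring {d : ℕ} (c : (Fin d → ℕ) → ℕ) : ZInvariant (diffColouring c) := by
  intro s z
  obtain ⟨x, hx, rfl⟩ := s.exists_eq_ofStrictMono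
  rw [Subsets.shift_ofStrictMono, diffColouring_ofStrictMono, diffColouring_ofStrictMono]
  exact congrArg c (funext fun i => Nat.add_sub_add_right _ _ _)

theorem strictMono_partialSum_iff {d : ℕ} {v : Fin d → ℕ} :
    StrictMono (Fin.partialSum v) ↔ ∀ i, v i ≠ 0 := by
  simp [Fin.strictMono_iff_lt_succ, Fin.partialSum_succ, Nat.pos_iff_ne_zero]

theorem tupleColouringCode_sumColouring {d : ℕ} (c : Subsets (d + 1) → ℕ) (m : ℕ) :
    (if (ofNat (List ℕ) m).length = d ∧ (ofNat (List ℕ) m).prod ≠ 0 then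
        subsetColouringCode c (encode (partialSums d (ofNat (List ℕ) m))) else 0) =
      tupleColouringCode (sumColouring c) m := by
  by_cases hlen : (ofNat (List ℕ) m).length = d
  · obtain ⟨v, hv⟩ := exists_eq_ofFn hlen
    simp only [tupleColouringCode_of_eq_ofFn _ hv, hv, list_prod_ofFn_ne_zero, sumColouring]
    by_cases h : ∀ i, v i ≠ 0
    · rw [if_pos ⟨by simp, h⟩, dif_pos (strictMono_partialSum_iff.2 h)]
      exact subsetColouringCode_of_eq_ofFn c (by rw [ofNat_encode, partialSums_ofFn]) _
    · rw [if_neg fun h' => h h'.2, dif_neg fun h' => h (strictMono_partialSum_iff.1 h')]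
  · rw [if_neg fun h => hlen h.1, tupleColouringCode, dif_neg hlen]

theorem subsetColouringCode_diffColouring {d : ℕ} (c : (Fin d → ℕ) → ℕ) (m : ℕ) :
    (if (ofNat (List ℕ) m).length = d + 1 ∧ (differences d (ofNat (List ℕ) m)).prod ≠ 0 then
        tupleColouringCode c (encode (differences d (ofNat (List ℕ) m))) else 0) =
      subsetColouringCode (diffColouring c) m := by
  by_cases hlen : (ofNat (List ℕ) m).length = d + 1
  · obtain ⟨x, hx⟩ := exists_eq_ofFn hlen
    -- Truncated subtraction gives `0` wherever `x` fails to increase.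
    have hmono : (differences d (ofNat (List ℕ) m)).prod ≠ 0 ↔ StrictMono x := by
      rw [hx, differences_ofFn, list_prod_ofFn_ne_zero, Fin.strictMono_iff_lt_succ]
      simp [Nat.sub_eq_zero_iff_le]
    by_cases h : StrictMono x
    · rw [if_pos ⟨hlen, hmono.2 h⟩, subsetColouringCode_of_eq_ofFn _ hx h,
        diffColouring_ofStrictMono]
      exact tupleColouringCode_of_eq_ofFn c (by rw [ofNat_encode, hx, differences_ofFn])
    · rw [if_neg fun h' => h (hmono.1 h'.2), subsetColouringCode, dif_neg]
      rintro ⟨h', -⟩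
      rw [hx, pairwise_ofFn_iff] at h'
      exact h h'
  · rw [if_neg fun h => hlen h.1, subsetColouringCode, dif_neg fun h => hlen h.2]

end Weihrauch

/-! ## The two reductions -/

namespace Weihrauch

open Encodable Denumerable

theorem enum_strictMono {X : Set ℕ} (h : X.Infinite) : StrictMono (enum X) := Nat.nth_strictMono h

theorem range_enum {X : Set ℕ} (h : X.Infinite) : Set.range (enum X) = X :=
  Nat.range_nth_of_infinite h

theorem infinite_range {f : ℕ → ℕ} (hf : StrictMono f) : (Set.range f).Infinite :=
  Set.infinite_range_of_injective hf.injective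

theorem enum_range {f : ℕ → ℕ} (hf : StrictMono f) : enum (Set.range f) = f :=
  ((enum_strictMono (infinite_range hf)).range_inj hf).1 (range_enum (infinite_range hf))

theorem setCode_eq_ite (X : Set ℕ) (n : ℕ) [Decidable (n ∈ X)] :
    setCode X n = if n ∈ X then 1 else 0 := by
  classical
  rw [setCode, Set.indicator_apply]
  congr

theorem setCode_ne_zero {X : Set ℕ} {n : ℕ} : setCode X n ≠ 0 ↔ n ∈ X := by
  classical
  simp [setCode_eq_ite]

theorem lt_of_mu_lt_lam {a b : ℕ} (h : mu a < lam b) : a < b := by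
  -- `lam 0` has the default value `0`, which cannot exceed `mu a`.
  have hb : b ≠ 0 := by
    rintro rfl
    simp [lam] at h
  calc a < 2 ^ (mu a + 1) := Nat.lt_pow_succ_log_self (by norm_num) a
    _ ≤ 2 ^ lam b := Nat.pow_le_pow_right (by norm_num) h
    _ ≤ b := Nat.le_of_dvd (Nat.pos_of_ne_zero hb) pow_padicValNat_dvd

/-- From the characteristic function of a set, that of the set of the sums of its initial
segments. -/
theorem computes_partialSums : Computes fun X n =>
    if ∃ m, m < n + 2 ∧ ∑ i ∈ Finset.range m, i * X i = n then 1 else 0 := by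
  have hs : Computes fun X m => ∑ i ∈ Finset.range m, i * X i :=
    Computes.sum_range (H := fun X _ i => i * X i) (.mul .snd (.oracle .snd)) .id
  refine Computes.exists_lt
    (H := fun X n m => if ∑ i ∈ Finset.range m, i * X i = n then 1 else 0)
    (.ite_eq (hs.comp .snd) .fst) (.add .id (.const 2)) fun X n => ?_
  simp

theorem sum_range_setCode {Y : Set ℕ} [DecidablePred (· ∈ Y)] (m : ℕ) :
    ∑ i ∈ Finset.range m, i * setCode Y i = ∑ t ∈ Finset.range (Nat.count (· ∈ Y) m), enum Y t := by
  induction m with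
  | zero => simp
  | succ m ih =>
    rw [Finset.sum_range_succ, ih, Nat.count_succ, setCode_eq_ite]
    by_cases hm : m ∈ Y
    · have : enum Y (Nat.count (· ∈ Y) m) = m := Nat.nth_count hm
      simp [hm, Finset.sum_range_succ, this]
    · simp [hm]

/-- The last summand `enum Y k` is at most the sum `n`, so the cut-off `m = enum Y k + 1` is below
`n + 2`. -/
theorem mem_range_partialSums_iff {Y : Set ℕ} (hY : Y.Infinite) {n : ℕ} :
    n ∈ Set.range (fun k => ∑ t ∈ Finset.range k, enum Y t) ↔
      ∃ m, m < n + 2 ∧ ∑ i ∈ Finset.range m, i * setCode Y i = n := by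
  classical
  simp only [sum_range_setCode]
  constructor
  · rintro ⟨k, rfl⟩
    cases k with
    | zero => exact ⟨0, by simp, by simp⟩
    | succ k =>
      refine ⟨enum Y k + 1, ?_, ?_⟩
      · simp only [Finset.sum_range_succ]
        omega
      · rw [enum, Nat.count_nth_succ_of_infinite (p := (· ∈ Y)) hY]
  · rintro ⟨m, -, h⟩
    exact ⟨_, h⟩

theorem sum_Ico_eq_sub {y x : ℕ → ℕ} (h : ∀ n, x (n + 1) = x n + y n) {a b : ℕ} (hab : a ≤ b) :
    ∑ t ∈ Finset.Ico a b, y t = x b - x a := by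
  have : x a + ∑ t ∈ Finset.Ico a b, y t = x b := by
    induction b, hab using Nat.le_induction with
    | base => simp
    | succ b hab ih => rw [Finset.sum_Ico_succ_top hab, ← add_assoc, ih, h]
  omega

theorem eq_partialSum_add {n : ℕ} {x : Fin (n + 1) → ℕ} (hx : StrictMono x) (i : Fin (n + 1)) :
    Fin.partialSum (fun j : Fin n => x j.succ - x j.castSucc) i + x 0 = x i := by
  induction i using Fin.induction with
  | zero => simp
  | succ i ih =>
    have := hx (Fin.castSucc_lt_succ (i := i))
    rw [Fin.partialSum_succ]
    omega

/-- The partial sums of the differences are `x` translated down by `x 0`; invariance undoes the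
translation. -/
theorem sumColouring_differences {d : ℕ} {c : Subsets (d + 1) → ℕ} (hc : ZInvariant c)
    {x : Fin (d + 1) → ℕ} (hx : StrictMono x) :
    sumColouring c (fun j => x j.succ - x j.castSucc) = c (.ofStrictMono x hx) := by
  have h : StrictMono (Fin.partialSum fun j : Fin d => x j.succ - x j.castSucc) := by
    rw [strictMono_partialSum_iff]
    exact fun j => (Nat.sub_pos_of_lt (hx Fin.castSucc_lt_succ)).ne'
  rw [sumColouring, dif_pos h, ← hc _ (x 0), Subsets.shift_ofStrictMono]
  congr
  exact funext (eq_partialSum_add hx)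

theorem exists_lift_range {n : ℕ} {f : ℕ → ℕ} (hf : StrictMono f) {x : Fin n → ℕ}
    (hx : StrictMono x) (h : Set.range x ⊆ Set.range f) :
    ∃ k : Fin n → ℕ, StrictMono k ∧ x = f ∘ k := by
  choose k hk using fun i => h ⟨i, rfl⟩
  refine ⟨k, fun i j hij => hf.lt_iff_lt.1 ?_, (funext hk).symm⟩
  rw [hk, hk]
  exact hx hij

theorem sepZRT_reducible_apAHT (d : ℕ) : StrongReducible (sepZRT (d + 1)) (apAHT d) := by
  refine ⟨_, _, computes_recode (primrec_partialSums d) primrec_list_prod d, computes_partialSums,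
    ?_⟩
  rintro ⟨c, ⟨k, hk⟩, hc⟩
  refine ⟨⟨sumColouring c, k + 1, fun v => ?_⟩,
    fun m => congrArg Part.some (tupleColouringCode_sumColouring c m), ?_⟩
  · rw [sumColouring]
    split_ifs
    · exact Nat.lt_succ_of_lt (hk _)
    · exact Nat.succ_pos k
  rintro Y ⟨hinf, hap, i, hi⟩
  have hx : StrictMono fun k => ∑ t ∈ Finset.range k, enum Y t :=
    strictMono_nat_of_lt_succ fun n => by
      rw [Finset.sum_range_succ]
      exact Nat.lt_add_of_pos_right (Nat.pos_of_ne_zero (hap n).1)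
  have hstep : ∀ n, ∑ t ∈ Finset.range (n + 1), enum Y t =
      ∑ t ∈ Finset.range n, enum Y t + enum Y n := fun n => Finset.sum_range_succ _ n
  refine ⟨Set.range fun k => ∑ t ∈ Finset.range k, enum Y t, fun n => ?_, infinite_range hx, ?_, i,
    fun s hs => ?_⟩
  · classical
    refine congrArg Part.some ?_
    change _ = setCode _ n
    rw [setCode_eq_ite]
    exact if_congr (mem_range_partialSums_iff hinf).symm rfl rfl
  · intro n
    rw [enum_range hx]
    simpa only [hstep, Nat.add_sub_cancel_left] using (hap n).2
  · obtain ⟨x, hxm, rfl⟩ := s.exists_eq_ofStrictMono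
    rw [Subsets.coe_ofStrictMono] at hs
    obtain ⟨k, hkm, rfl⟩ := exists_lift_range hx hxm hs
    change c _ = i
    rw [← sumColouring_differences hc hxm]
    refine hi _ ⟨k, hkm, fun j => ?_⟩
    exact (sum_Ico_eq_sub (x := fun k => ∑ t ∈ Finset.range k, enum Y t) hstep (hkm Fin.castSucc_lt_succ).le).symm

/-- `X` has no elements in the interval from `a + 1` to `a + n`. -/
def noneAfter (X : ℕ → ℕ) (a n : ℕ) : ℕ :=
  if ∑ t ∈ Finset.range n, X (a + 1 + t) = 0 then 1 else 0

theorem noneAfter_setCode_ne_zero {X : Set ℕ} {a n : ℕ} :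
    noneAfter (setCode X) a n ≠ 0 ↔ ∀ b ∈ X, a < b → a + n < b := by
  have : noneAfter (setCode X) a n ≠ 0 ↔ ∀ t < n, a + 1 + t ∉ X := by
    simp [noneAfter, ← setCode_ne_zero]
  rw [this]
  constructor
  · intro h b hb hab
    by_contra! hle
    refine h (b - (a + 1)) (by omega) ?_
    rwa [Nat.add_sub_cancel' hab]
  · intro h t ht hX
    have := h _ hX (by omega)
    omega

theorem computes_noneAfter {F G : (ℕ → ℕ) → ℕ → ℕ} (hF : Computes F) (hG : Computes G) :
    Computes fun X m => noneAfter X (F X m) (G X m) := by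
  have h : Computes fun X p => noneAfter X p.unpair.1 p.unpair.2 :=
    .ite_eq (Computes.sum_range (H := fun X p t => X (p.unpair.1 + 1 + t))
      (.oracle (.add (.add (.comp .fst .fst) (.const 1)) .snd)) .snd) (.const 0)
  simpa only [Nat.unpair_pair] using h.comp (hF.pair hG)

/-- `n` is the difference of two consecutive elements of `X` the smaller one of which is below
`a`. -/
def IsGapBelow (X : ℕ → ℕ) (n a : ℕ) : Prop :=
  ∃ b, b < a ∧ X b * X (b + n) * n * noneAfter X b (n - 1) ≠ 0

instance (X : ℕ → ℕ) (n a : ℕ) : Decidable (IsGapBelow X n a) :=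
  inferInstanceAs (Decidable (∃ b, b < a ∧ X b * X (b + n) * n * noneAfter X b (n - 1) ≠ 0))

theorem computes_isGapBelow :
    Computes fun X m => if IsGapBelow X m.unpair.1 m.unpair.2 then 1 else 0 :=
  Computes.exists_lt (H := fun X m b => X b * X (b + m.unpair.1) * m.unpair.1 *
      noneAfter X b (m.unpair.1 - 1))
    (.mul (.mul (.mul (.oracle .snd) (.oracle (.add .snd (.comp .fst .fst)))) (.comp .fst .fst))
      (computes_noneAfter .snd (.sub (.comp .fst .fst) (.const 1)))) .snd fun _ _ => Iff.rfl

/-- From the characteristic function of a set with increasing gaps, that of the set of its gaps: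
search for a gap longer than `n`, and look for a gap of length `n` before it. -/
theorem isTuringFunctional_gaps : IsTuringFunctional fun X n =>
    (Nat.rfind fun a => Part.some (decide (1 - X a * noneAfter X a n = 0))) >>=
      fun a => Part.some (if IsGapBelow X n a then 1 else 0) := by
  have h := isTuringFunctional_comp_rfind (F := fun X m => 1 - X m.unpair.2 *
    noneAfter X m.unpair.2 m.unpair.1) (.sub (.const 1) (.mul (.oracle .snd)
      (computes_noneAfter .snd .fst))) computes_isGapBelow
  simpa only [Nat.unpair_pair] using h

theorem isGapBelow_setCode {X : Set ℕ} {n a : ℕ} :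
    IsGapBelow (setCode X) n a ↔
      ∃ b < a, b ∈ X ∧ b + n ∈ X ∧ n ≠ 0 ∧ ∀ c ∈ X, b < c → b + n ≤ c := by
  unfold IsGapBelow
  simp only [mul_ne_zero_iff, setCode_ne_zero, noneAfter_setCode_ne_zero, and_assoc]
  refine exists_congr fun b => and_congr_right fun _ => and_congr_right fun _ =>
    and_congr_right fun _ => and_congr_right fun hn => forall₃_congr fun c _ _ => ?_
  -- As `n ≠ 0`, `b + (n - 1) < c` says the same as `b + n ≤ c`.
  omega

/-- The search stops at some `x k` whose gap exceeds `n`. Since gaps increase, a gap equal to `n`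
can only start before `x k`, so a bounded check decides whether there is one. -/
theorem gaps_setCode {x : ℕ → ℕ} (hx : StrictMono x) (hy : StrictMono fun n => x (n + 1) - x n)
    (n : ℕ) :
    ((Nat.rfind fun a => Part.some (decide (1 - setCode (Set.range x) a *
        noneAfter (setCode (Set.range x)) a n = 0))) >>=
      fun a => Part.some (if IsGapBelow (setCode (Set.range x)) n a then 1 else 0)) =
      Part.some (setCode (Set.range fun n => x (n + 1) - x n) n) := by
  have hlt : ∀ k, x k < x (k + 1) := fun k => hx k.lt_succ_self
  have hnext : ∀ k, ∀ c ∈ Set.range x, x k < c → x (k + 1) ≤ c := by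
    rintro k _ ⟨j, rfl⟩ h
    exact hx.monotone (hx.lt_iff_lt.1 h)
  have hsearch : ∀ a, 1 - setCode (Set.range x) a * noneAfter (setCode (Set.range x)) a n = 0 ↔
      ∃ k, x k = a ∧ n < x (k + 1) - x k := by
    intro a
    rw [Nat.sub_eq_zero_iff_le, Nat.one_le_iff_ne_zero, mul_ne_zero_iff, setCode_ne_zero,
      noneAfter_setCode_ne_zero]
    constructor
    · rintro ⟨⟨k, rfl⟩, h⟩
      have := h _ ⟨k + 1, rfl⟩ (hlt k)
      exact ⟨k, rfl, by omega⟩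
    · rintro ⟨k, rfl, h⟩
      refine ⟨⟨k, rfl⟩, fun b hb hkb => ?_⟩
      have := hnext k b hb hkb
      omega
  -- The search terminates: in a strictly increasing sequence, the gap with index `n + 1` is at
  -- least `n + 1`.
  have hbig : n < x (n + 1 + 1) - x (n + 1) := Nat.lt_of_succ_le (hy.id_le (n + 1))
  obtain ⟨a, ha, -⟩ := Nat.rfind_min' (p := fun a => decide (1 - setCode (Set.range x) a *
    noneAfter (setCode (Set.range x)) a n = 0)) (decide_eq_true ((hsearch _).2 ⟨n + 1, rfl, hbig⟩))
  have hspec : ∃ k, x k = a ∧ n < x (k + 1) - x k := by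
    simpa [hsearch] using Nat.rfind_spec ha
  have hrf : (Nat.rfind fun a => Part.some (decide (1 - setCode (Set.range x) a *
      noneAfter (setCode (Set.range x)) a n = 0))) = Part.some a := Part.eq_some_iff.2 ha
  obtain ⟨k, rfl, hk⟩ := hspec
  rw [hrf]
  classical
  rw [setCode_eq_ite (Set.range fun n => x (n + 1) - x n) n]
  refine (Part.bind_some _ _).trans (congrArg Part.some (if_congr ?_ rfl rfl))
  rw [isGapBelow_setCode]
  constructor
  · rintro ⟨_, -, ⟨j, rfl⟩, hjn, hn, hmin⟩
    have h₁ := hmin _ ⟨j + 1, rfl⟩ (hlt j)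
    have h₂ := hnext j _ hjn (by omega)
    exact ⟨j, by dsimp only; omega⟩
  · rintro ⟨j, rfl⟩
    have hj := hlt j
    dsimp only at hk ⊢
    have hjk : x j + (x (j + 1) - x j) = x (j + 1) := by omega
    refine ⟨x j, hx (hy.lt_iff_lt.1 hk), ⟨j, rfl⟩, ?_⟩
    rw [hjk]
    exact ⟨⟨j + 1, rfl⟩, by omega, hnext j⟩

theorem apAHT_reducible_sepZRT (d : ℕ) : StrongReducible (apAHT d) (sepZRT (d + 1)) := by
  refine ⟨_, _, computes_recode (primrec_differences d)
    (primrec_list_prod.comp (primrec_differences d)) (d + 1), isTuringFunctional_gaps, ?_⟩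
  rintro ⟨c, k, hk⟩
  refine ⟨⟨diffColouring c, ⟨k, fun s => hk _⟩, zInvariant_diffColouring c⟩,
    fun m => congrArg Part.some (subsetColouringCode_diffColouring c m), ?_⟩
  rintro X ⟨hinf, hsep, i, hi⟩
  have hx := enum_strictMono hinf
  have hy : StrictMono fun n => enum X (n + 1) - enum X n :=
    strictMono_nat_of_lt_succ fun n => lt_of_mu_lt_lam (hsep n)
  refine ⟨Set.range fun n => enum X (n + 1) - enum X n, fun n => ?_, infinite_range hy, ?_, i, ?_⟩
  · have := gaps_setCode hx hy n
    rwa [range_enum hinf] at this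
  · rw [enum_range hy]
    exact fun n => ⟨(Nat.sub_pos_of_lt (hx n.lt_succ_self)).ne', hsep n⟩
  · rw [enum_range hy]
    rintro v ⟨k, hk, hv⟩
    -- Sums of adjacent gaps telescope to differences of elements of `X`.
    have hv' : v = fun j => (enum X ∘ k) j.succ - (enum X ∘ k) j.castSucc := funext fun j => by
      rw [hv]
      refine sum_Ico_eq_sub (fun n => ?_) (hk Fin.castSucc_lt_succ).le
      have : enum X n < enum X (n + 1) := hx n.lt_succ_self
      omega
    have := hi (.ofStrictMono _ (hx.comp hk)) (by
      rw [Subsets.coe_ofStrictMono]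
      exact (Set.range_comp_subset_range _ _).trans (range_enum hinf).subset)
    rw [hv']
    exact (diffColouring_ofStrictMono c (hx.comp hk)).symm.trans this

end Weihrauch

theorem theorem4 (d : ℕ) (hd : 1 ≤ d) :
    Weihrauch.StrongEquivalent (Weihrauch.sepZRT (d + 1)) (Weihrauch.apAHT d) ∧
    ∀ (M : Type u) [Zero M] [One M] [Add M] [Mul M] [LT M] (S : Set (Set M)),
      SecondOrderArith.IsModelRCA0 S →
        (SecondOrderArith.SatSepZRT (d + 1) S ↔ SecondOrderArith.SatApAHT d S) := by
  exact ⟨⟨Weihrauch.sepZRT_reducible_apAHT d, Weihrauch.apAHT_reducible_sepZRT d⟩,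
    fun _ _ _ _ _ _ _ hS => SecondOrderArith.satSepZRT_iff_satApAHT hS d⟩
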